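/- Let $C_0\ge 1$, $B>2C_0$, $C_1>0$ and $\varepsilon>0$ be constants. For each $n$ let $A\in\{0,1\}^{n\times n}$ be the adjacency matrix of a popularity adjusted block model: $A$ is symmetric with zero diagonal, and its entries $A_{ij}$, $i<j$, are independent with $A_{ij}\sim\mathrm{Bernoulli}(\theta_{ij})$, where $$\theta_{ij}=\lambda_{i\,c^*(j)}\lambda_{j\,c^*(i)},\qquad \Lambda=(\lambda_{ik})=\rho_n\Lambda_0,\quad \Lambda_0\in(0,1)^{n\times K},\quad \rho_n\in(0,1],\quad c^*\in[K]^n,$$ $\Theta=(\theta_{ij})_{i,j\in[n]}$, and $2\le K\le K_{\max}$; here $K$, $K_{\max}$, $\rho_n$, $\Lambda_0$ and $c^*$ may all depend on $n$. For $c\in[\tilde K]^n$ let $n_k(c)=|\{i:c(i)=k\}|$ and, for an $n\times n$ matrix $M$, let $$f(c,M)=\max_{k\in[\tilde K]}\sigma_2\big((M_{ij})_{i,j:\,c(i)=c(j)=k}\big),$$ where $\sigma_2$ is the second largest singular value ($0$ for a block with fewer than two rows). Call $c\in[\tilde K]^n$ $b$-balanced if $\frac{n}{b\tilde K}\le n_k(c)\le\frac{bn}{\tilde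 K}$ for all $k\in[\tilde K]$. For $\tilde K\in[K_{\max}]$ let $c_{\tilde K}$ be any minimizer of $f(\cdot,\Theta)$ over the $B$-balanced label vectors in $[\tilde K]^n$. Suppose that, for all sufficiently large $n$, 1. $c^*$ is $C_0$-balanced (with $\tilde K=K$); 2. $f(c_{\tilde K},\Theta)\ge C_1\,\dfrac{n\rho_n^2}{\tilde K\sqrt{\log n}}$ for every $1\le\tilde K<K$; 3. $K_{\max}\le n^{1-\varepsilon}$; and that $\rho_n^2\,n/K_{\max}\gg(\log n)^2$, i.e. $(\log n)^2=o(\rho_n^2 n/K_{\max})$ as $n\to\infty$. Then there is a constant $C>0$, depending only on $C_0,B,C_1,\varepsilon$, such that for all sufficiently large $n$, with probability at least $1-n^{-C}$, the ratio $$\tilde K\mapsto\frac{f(c_{\tilde K-1},A)}{f(c_{\tilde K},A)+\log n},\qquad \tilde K\in\{2,\dots,K_{\max}\},$$ has $\tilde K=K$ as its unique maximizer; that is, the estimator $\hat K=\operatorname{arg\,max}_{\tilde K\in\{2,\dots,K_{\max}\}}\frac{f(c_{\tilde K-1},A)}{f(c_{\tilde K},A)+\log n}$ satisfies $\hat K=K$.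 -/

import Mathlib

open Filter MeasureTheory ProbabilityTheory
open scoped Topology

noncomputable section

/-- The second largest singular value `σ₂(M)` of a real matrix
(the singular values of Mathlib are indexed from `0`); it is `0` if `M` has fewer than two columns. -/
def sigmaTwo {m n : Type*} [Fintype m] [Fintype n] [DecidableEq n] (M : Matrix m n ℝ) : ℝ :=
  (Matrix.toEuclideanLin M).singularValues 1

/-- `c ∈ [K]ⁿ`: all labels lie in `{1, …, K}`. -/
def IsLabeling {n : ℕ} (K : ℕ) (c : Fin n → ℕ) : Prop :=
  ∀ i, c i ∈ Set.Icc 1 K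

/-- The size `n_k(c)` of community `k`. -/
def communitySize {n : ℕ} (c : Fin n → ℕ) (k : ℕ) : ℕ :=
  Fintype.card {i // c i = k}

/-- All `K` community sizes lie in `[n / (B K), B n / K]`. -/
def IsBalanced {n : ℕ} (B : ℝ) (K : ℕ) (c : Fin n → ℕ) : Prop :=
  ∀ k ∈ Set.Icc 1 K,
    (n : ℝ) / (B * K) ≤ communitySize c k ∧ (communitySize c k : ℝ) ≤ B * n / K

/-- The diagonal block `M^{(k,k)}(c) = (M_{ij})_{i, j : c(i) = c(j) = k}`. -/
def diagBlock {n : ℕ} (c : Fin n → ℕ) (M : Matrix (Fin n) (Fin n) ℝ) (k : ℕ) :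
    Matrix {i // c i = k} {i // c i = k} ℝ :=
  M.submatrix Subtype.val Subtype.val

/-- `f(c, M) = max_{k ∈ [K]} σ₂(M^{(k,k)}(c))` for a label vector `c ∈ [K]ⁿ` with `K ≥ 1`. -/
def blockCriterion {n : ℕ} (K : ℕ) (c : Fin n → ℕ) (M : Matrix (Fin n) (Fin n) ℝ) : ℝ :=
  ⨆ k : Set.Icc 1 K, sigmaTwo (diagBlock c M k)

/-- The set of minimizers of `f(·, Θ)` over the label vectors in `[K]ⁿ` whose community sizes
all lie in `[n / (B K), B n / K]`. -/
def balancedArgmin {n : ℕ} (B : ℝ) (K : ℕ) (Θ : Matrix (Fin n) (Fin n) ℝ) : Set (Fin n → ℕ) :=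
  {c | IsLabeling K c ∧ IsBalanced B K c ∧
    ∀ c' : Fin n → ℕ, IsLabeling K c' → IsBalanced B K c' →
      blockCriterion K c Θ ≤ blockCriterion K c' Θ}

/-- The edge probabilities `θ_{ij} = λ_{i c(j)} λ_{j c(i)}` of the popularity adjusted block model.
If `c ∈ [K]ⁿ`, only the columns `1, …, K` of `lam` are used. -/
def pabmTheta {n : ℕ} (lam : Fin n → ℕ → ℝ) (c : Fin n → ℕ) : Matrix (Fin n) (Fin n) ℝ :=
  Matrix.of fun i j => lam i (c j) * lam j (c i)

/-- `A` is the random adjacency matrix of an undirected graph without self-loops, whose entries above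
the diagonal are independent, with `A_{ij} ~ Bernoulli(θ_{ij})`. -/
structure IsBernoulliGraph {n : ℕ} {Ω : Type*} [MeasurableSpace Ω] (P : Measure Ω)
    (Θ : Matrix (Fin n) (Fin n) ℝ) (A : Ω → Matrix (Fin n) (Fin n) ℝ) : Prop where
  measurable_entry : ∀ i j, Measurable fun ω => A ω i j
  zero_or_one : ∀ ω i j, A ω i j = 0 ∨ A ω i j = 1
  symmetric : ∀ ω i j, A ω i j = A ω j i
  no_loops : ∀ ω i, A ω i i = 0
  prob_edge : ∀ i j, i < j → P {ω | A ω i j = 1} = ENNReal.ofReal (Θ i j)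
  independent : iIndepFun
    (fun (e : {e : Fin n × Fin n // e.1 < e.2}) (ω : Ω) => A ω e.1.1 e.1.2) P

/-- The ratio `f(c_{t-1}, M) / (f(c_t, M) + log n)`, for a family `c` of label vectors. -/
def criterionRatio {n : ℕ} (c : ℕ → Fin n → ℕ) (M : Matrix (Fin n) (Fin n) ℝ) (t : ℕ) : ℝ :=
  blockCriterion (t - 1) (c (t - 1)) M / (blockCriterion t (c t) M + Real.log n)

/-- The set of all maximizers of the ratio over `t ∈ {2, …, Kmax}`; the estimator of the number of
communities is a point of this set. -/
def ratioArgmax {n : ℕ} (Kmax : ℕ) (c : ℕ → Fin n → ℕ) (M : Matrix (Fin n) (Fin n) ℝ) : Set ℕ :=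
  {t | t ∈ Set.Icc 2 Kmax ∧ ∀ s ∈ Set.Icc 2 Kmax, criterionRatio c M s ≤ criterionRatio c M t}

end

/-!
# Consistency of the ratio estimator for the number of communities

Write `x t = n ρ² / t` for the order of the expected degree inside a block of a balanced labeling
with `t` labels. The labelings `c t` depend only on `Θ`, so they are deterministic, and the whole
randomness enters through the operator norms of the blocks of the noise `A - Θ`. By Weyl's
inequality (`sigmaTwo_le_add`) the criterion `f (c t, A)` differs from `f (c t, Θ)` by at most the
largest of these norms, which is `O(√(x t))` uniformly in `t` with high probability
(`IsBernoulliGraph.measureReal_exists_block_noise_le`).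

On the population side, `Θ` has rank one on every set of vertices with a common true label. If
`t ≥ K`, the true communities can be subdivided into `t` parts of comparable size
(`isBalanced_refineLabel`), so that `f (c t, Θ) = 0`. If `t < K`, then `f (c t, Θ)` lies between
multiples of `x t / √(log n)` (by assumption) and `x t`. Hence the ratio is at least of order
`√(x K) / √(log n)` at `t = K`, at most of order `√(log n)` for `t < K`, and at most of order
`√(x K) / log n` for `t > K`. Since `√(x K) / log n → ∞`, the first of these is eventually the
largest (`ratio_lt_ratio`).

A logarithmic loss in the norm bound would be fatal here, so that the matrix Bernstein inequality
does not suffice. The bound is obtained by the trace method in the form of Bandeira and van Handel.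
Only closed walks that traverse each edge at least twice contribute to the expected trace of
the `2 q`-th power of a block of the noise, and such a walk with `v` vertices contributes at most
`p ^ (v - 1)` with `p = ρ²`. Instead of counting these walks, one compares with a dense symmetric
random matrix of the smaller dimension `r ≈ m p + q`, where `m` is the size of the block, whose
independent centred entries have all higher moments at least one: for every shape of walks
the contribution of the noise is at most `m / r` times that of the comparison matrix
(`sum_repeatingClosedWalk_le`). The operator norm of the latter is `O(√r)` by a standard net
argument (`sum_l2_opNorm_skewMatrix_pow_le`), and with `q` of order `log n ≤ √(x t)` this is
`O(√(x t))`.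
-/

/-! ### Perturbation of singular values -/

section SingularValues

open Module

variable {E F : Type*} [NormedAddCommGroup E] [InnerProductSpace ℝ E] [FiniteDimensional ℝ E]
  [NormedAddCommGroup F] [InnerProductSpace ℝ F] [FiniteDimensional ℝ F]

/-- The singular values diagonalize the quadratic form `‖T x‖²`. -/
theorem LinearMap.exists_orthonormalBasis_norm_sq_apply (T : E →ₗ[ℝ] F) :
    ∃ b : OrthonormalBasis (Fin (finrank ℝ E)) ℝ E,
      ∀ x, ‖T x‖ ^ 2 = ∑ j : Fin (finrank ℝ E), T.singularValues j ^ 2 * inner ℝ (b j) x ^ 2 := by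
  have hT := T.isSymmetric_adjoint_comp_self
  refine ⟨hT.eigenvectorBasis rfl, fun x => ?_⟩
  have h1 : ‖T x‖ ^ 2 = inner ℝ ((LinearMap.adjoint T ∘ₗ T) x) x := by
    rw [LinearMap.comp_apply, LinearMap.adjoint_inner_left, real_inner_self_eq_norm_sq]
  rw [h1, ← (hT.eigenvectorBasis rfl).sum_inner_mul_inner]
  refine Finset.sum_congr rfl fun j _ => ?_
  rw [T.sq_singularValues_fin rfl j, hT x, hT.apply_eigenvectorBasis rfl j,
    real_inner_smul_right, real_inner_comm]
  simp
  ring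

/-- Weyl's inequality for singular values. -/
theorem LinearMap.singularValues_le_add (T S : E →ₗ[ℝ] F) {c : ℝ}
    (hc : ∀ x, ‖T x - S x‖ ≤ c * ‖x‖) (i : ℕ) (hi : i < finrank ℝ E) :
    T.singularValues i ≤ S.singularValues i + c := by
  obtain ⟨bT, hT⟩ := T.exists_orthonormalBasis_norm_sq_apply
  obtain ⟨bS, hS⟩ := S.exists_orthonormalBasis_norm_sq_apply
  -- By dimension count, some `x ≠ 0` lies in the span of the first `i + 1` right singular vectors
  -- of `T` and is orthogonal to the first `i` right singular vectors of `S`.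
  let φ : E →ₗ[ℝ] (Fin (finrank ℝ E - 1) → ℝ) := LinearMap.pi fun j =>
    if (j : ℕ) < i then innerₗ E (bS ⟨j, by omega⟩) else innerₗ E (bT ⟨j + 1, by omega⟩)
  have hker : LinearMap.ker φ ≠ ⊥ := LinearMap.ker_ne_bot_of_finrank_lt (by simp; omega)
  obtain ⟨x, hx, hx0⟩ := Submodule.exists_mem_ne_zero_of_ne_bot hker
  have hφ : ∀ j, φ x j = 0 := fun j => by rw [LinearMap.mem_ker.1 hx]; rfl
  have hxS : ∀ j : Fin (finrank ℝ E), (j : ℕ) < i → inner ℝ (bS j) x = 0 := fun j hj => by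
    have := hφ ⟨j, by omega⟩
    simpa [φ, hj] using this
  have hxT : ∀ j : Fin (finrank ℝ E), i < (j : ℕ) → inner ℝ (bT j) x = 0 := fun j hj => by
    have := hφ ⟨j - 1, by omega⟩
    have h2 : ¬ ((j : ℕ) - 1 < i) := by omega
    have h3 : (j : ℕ) - 1 + 1 = j := by omega
    simpa [φ, h2, h3] using this
  have normT : ∑ j, inner ℝ (bT j) x ^ 2 = ‖x‖ ^ 2 := by
    simpa using bT.sum_sq_norm_inner_right x
  have normS : ∑ j, inner ℝ (bS j) x ^ 2 = ‖x‖ ^ 2 := by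
    simpa using bS.sum_sq_norm_inner_right x
  have h1 : (T.singularValues i * ‖x‖) ^ 2 ≤ ‖T x‖ ^ 2 := by
    rw [mul_pow, hT, ← normT, Finset.mul_sum]
    refine Finset.sum_le_sum fun j _ => ?_
    rcases le_or_gt (j : ℕ) i with h | h
    · gcongr
      · exact T.singularValues_nonneg _
      · exact T.singularValues_antitone h
    · simp [hxT j h]
  have h2 : ‖S x‖ ^ 2 ≤ (S.singularValues i * ‖x‖) ^ 2 := by
    rw [mul_pow, hS, ← normS, Finset.mul_sum]
    refine Finset.sum_le_sum fun j _ => ?_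
    rcases lt_or_ge (j : ℕ) i with h | h
    · simp [hxS j h]
    · gcongr
      · exact S.singularValues_nonneg _
      · exact S.singularValues_antitone h
  have h1' := le_of_sq_le_sq h1 (norm_nonneg _)
  have h2' := le_of_sq_le_sq h2 (mul_nonneg (S.singularValues_nonneg _) (norm_nonneg _))
  have h3 : ‖T x‖ ≤ ‖S x‖ + ‖T x - S x‖ := by
    simpa using norm_add_le (S x) (T x - S x)
  have h4 : T.singularValues i * ‖x‖ ≤ (S.singularValues i + c) * ‖x‖ := by
    linarith [hc x]
  exact le_of_mul_le_mul_right h4 (norm_pos_iff.2 hx0)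

end SingularValues

section SigmaTwo

open scoped Matrix.Norms.L2Operator

variable {m n : Type*} [Fintype m] [Fintype n] [DecidableEq n]

theorem sigmaTwo_nonneg (M : Matrix m n ℝ) : 0 ≤ sigmaTwo M :=
  LinearMap.singularValues_nonneg _ _

theorem sigmaTwo_le_add (M M' : Matrix m n ℝ) : sigmaTwo M ≤ sigmaTwo M' + ‖M - M'‖ := by
  rcases lt_or_ge 1 (Module.finrank ℝ (EuclideanSpace ℝ n)) with h | h
  · refine LinearMap.singularValues_le_add _ _ (fun x => ?_) 1 h
    rw [← LinearMap.sub_apply, ← map_sub]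
    exact Matrix.l2_opNorm_mulVec (M - M') x
  · have : sigmaTwo M = 0 := LinearMap.singularValues_of_finrank_le _ h
    rw [this]
    have := sigmaTwo_nonneg M'
    positivity

theorem sigmaTwo_le_norm (M : Matrix m n ℝ) : sigmaTwo M ≤ ‖M‖ := by
  have h : sigmaTwo (0 : Matrix m n ℝ) = 0 := by simp [sigmaTwo]
  simpa [h] using sigmaTwo_le_add M 0

theorem sigmaTwo_vecMulVec (u : m → ℝ) (v : n → ℝ) : sigmaTwo (Matrix.vecMulVec u v) = 0 := by
  refine LinearMap.singularValues_eq_zero_iff_le_finrank_range _ |>.2 ?_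
  have h := Matrix.rank_vecMulVec_le u v
  rwa [Matrix.rank_eq_finrank_range_toLin _ (EuclideanSpace.basisFun m ℝ).toBasis
    (EuclideanSpace.basisFun n ℝ).toBasis, ← Matrix.toEuclideanLin_eq_toLin_orthonormal] at h

/-- The operator norm is at most the Frobenius norm. -/
theorem l2_opNorm_sq_le_sum_sq (M : Matrix m n ℝ) : ‖M‖ ^ 2 ≤ ∑ i, ∑ j, M i j ^ 2 := by
  have h0 : 0 ≤ ∑ i, ∑ j, M i j ^ 2 := by positivity
  have h : ‖M‖ ≤ √(∑ i, ∑ j, M i j ^ 2) := by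
    rw [Matrix.l2_opNorm_def]
    refine ContinuousLinearMap.opNorm_le_bound _ (Real.sqrt_nonneg _) fun x => ?_
    refine le_of_sq_le_sq ?_ (by positivity)
    rw [mul_pow, Real.sq_sqrt h0, EuclideanSpace.real_norm_sq_eq, EuclideanSpace.real_norm_sq_eq,
      Finset.sum_mul]
    refine Finset.sum_le_sum fun i _ => ?_
    exact Finset.sum_mul_sq_le_sq_mul_sq _ _ _
  calc ‖M‖ ^ 2 ≤ √(∑ i, ∑ j, M i j ^ 2) ^ 2 := by gcongr
    _ = _ := Real.sq_sqrt h0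

theorem l2_opNorm_le_card_mul (M : Matrix n n ℝ) {p : ℝ} (hp : ∀ i j, |M i j| ≤ p) (hp0 : 0 ≤ p) :
    ‖M‖ ≤ Fintype.card n * p := by
  refine le_of_sq_le_sq ((l2_opNorm_sq_le_sum_sq M).trans ?_) (by positivity)
  calc ∑ i, ∑ j, M i j ^ 2 ≤ ∑ _i : n, ∑ _j : n, p ^ 2 := by
        refine Finset.sum_le_sum fun i _ => Finset.sum_le_sum fun j _ => ?_
        rw [← sq_abs]
        exact pow_le_pow_left₀ (abs_nonneg _) (hp i j) 2
    _ = _ := by simp; ring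

/-- The squared Frobenius norm is the sum of the squared lengths of the columns. -/
theorem sum_sq_le_card_mul_l2_opNorm_sq (M : Matrix m n ℝ) :
    ∑ i, ∑ j, M i j ^ 2 ≤ Fintype.card n * ‖M‖ ^ 2 := by
  rw [Finset.sum_comm]
  calc ∑ j, ∑ i, M i j ^ 2 ≤ ∑ _j : n, ‖M‖ ^ 2 := by
        refine Finset.sum_le_sum fun j _ => ?_
        have h := Matrix.l2_opNorm_mulVec M (EuclideanSpace.single j 1)
        rw [PiLp.norm_single, norm_one, mul_one] at h
        have h2 := pow_le_pow_left₀ (norm_nonneg _) h 2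
        rw [EuclideanSpace.real_norm_sq_eq] at h2
        simpa using h2
    _ = _ := by simp

variable {M : Matrix n n ℝ}

theorem trace_pow_two_mul_of_isSymm (hM : M.IsSymm) (q : ℕ) :
    (M ^ (2 * q)).trace = ∑ i, ∑ j, (M ^ q) i j ^ 2 := by
  have h : (M ^ q).IsSymm := hM.pow q
  rw [two_mul, pow_add, Matrix.trace]
  refine Finset.sum_congr rfl fun i _ => ?_
  rw [Matrix.diag_apply, Matrix.mul_apply]
  refine Finset.sum_congr rfl fun j _ => ?_
  rw [h.apply i j]; ring

/-- For exponents that are powers of two, the operator norm of a symmetric matrix is controlled by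
the trace of a power through the C⋆-identity. -/
theorem l2_opNorm_pow_le_trace (hM : M.IsSymm) (k : ℕ) :
    ‖M‖ ^ (2 * 2 ^ k) ≤ (M ^ (2 * 2 ^ k)).trace := by
  have hs : IsSelfAdjoint M := by
    rw [IsSelfAdjoint, Matrix.star_eq_conjTranspose, Matrix.conjTranspose_eq_transpose_of_trivial]
    exact hM
  rw [trace_pow_two_mul_of_isSymm hM, mul_comm 2, pow_mul, ← hs.norm_pow_two_pow]
  exact l2_opNorm_sq_le_sum_sq _

theorem trace_pow_le_card_mul (hM : M.IsSymm) (q : ℕ) :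
    (M ^ (2 * q)).trace ≤ Fintype.card n * ‖M‖ ^ (2 * q) := by
  rw [trace_pow_two_mul_of_isSymm hM]
  refine (sum_sq_le_card_mul_l2_opNorm_sq _).trans ?_
  rw [mul_comm 2 q, pow_mul]
  gcongr
  rcases isEmpty_or_nonempty n with h | h
  · have : M ^ q = 0 := Subsingleton.elim _ _
    simp [this]
  · exact norm_pow_le _ _

end SigmaTwo

/-! ### Walks and their shapes -/

section Walks

variable {V R : Type*} {N : ℕ}

/-- The undirected edge traversed in step `l` of a walk, given by its sequence of vertices. -/
def walkEdge (w : Fin (N + 1) → V) (l : Fin N) : Sym2 V :=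
  s(w l.castSucc, w l.succ)

/-- Every edge of the walk is traversed at least twice. -/
def RepeatsEdges (w : Fin (N + 1) → V) : Prop :=
  ∀ l, ∃ l', l' ≠ l ∧ walkEdge w l' = walkEdge w l

/-- A closed walk each of whose edges is traversed at least twice. These are the walks that
contribute to trace moments of a symmetric random matrix with independent centred entries. -/
def IsRepeatingClosedWalk (w : Fin (N + 1) → V) : Prop :=
  w 0 = w (Fin.last N) ∧ RepeatsEdges w

/-- Whether a walk is closed and repeats its edges depends only on its shape, that is, on the
partition of the times according to the vertex visited. -/
theorem isRepeatingClosedWalk_of_ker_eq {w : Fin (N + 1) → V} {w' : Fin (N + 1) → R}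
    (h : Setoid.ker w = Setoid.ker w') (hw : IsRepeatingClosedWalk w) :
    IsRepeatingClosedWalk w' := by
  have hk : ∀ a b, w a = w b ↔ w' a = w' b := fun a b => by
    rw [← Setoid.ker_def, h, Setoid.ker_def]
  refine ⟨(hk _ _).1 hw.1, fun l => ?_⟩
  obtain ⟨l', h1, h2⟩ := hw.2 l
  refine ⟨l', h1, ?_⟩
  simp only [walkEdge, Sym2.eq_iff] at h2 ⊢
  simpa only [hk] using h2

theorem Matrix.pow_apply_eq_sum_walk [Fintype V] [DecidableEq V] (M : Matrix V V ℝ) (N : ℕ)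
    (i j : V) :
    (M ^ N) i j = ∑ w : Fin (N + 1) → V, if w 0 = i ∧ w (Fin.last N) = j then
      ∏ l : Fin N, M (w l.castSucc) (w l.succ) else 0 := by
  induction N generalizing i with
  | zero =>
    rw [← (Equiv.funUnique (Fin 1) V).symm.sum_comp]
    simp [Matrix.one_apply, ite_and]
  | succ N ih =>
    symm
    rw [pow_succ', Matrix.mul_apply, ← (Fin.consEquiv fun _ => V).sum_comp,
      Fintype.sum_prod_type, Finset.sum_eq_single i]
    · simp_rw [ih, Finset.mul_sum]
      rw [Finset.sum_comm]
      refine Finset.sum_congr rfl fun w _ => ?_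
      rw [Finset.sum_eq_single (w 0)]
      · simp [Fin.prod_univ_succ, Fin.consEquiv, ← Fin.succ_last, Fin.castSucc_succ]
      · intro k _ hk
        simp [hk.symm]
      · simp
    · intro a _ ha
      simp [Fin.consEquiv, ha]
    · simp

theorem Matrix.trace_pow_eq_sum_walk [Fintype V] [DecidableEq V] (M : Matrix V V ℝ) (N : ℕ) :
    (M ^ N).trace = ∑ w : Fin (N + 1) → V, if w 0 = w (Fin.last N) then
      ∏ l : Fin N, M (w l.castSucc) (w l.succ) else 0 := by
  simp_rw [Matrix.trace, Matrix.diag_apply, Matrix.pow_apply_eq_sum_walk]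
  rw [Finset.sum_comm]
  refine Finset.sum_congr rfl fun w _ => ?_
  simp [ite_and, eq_comm]

variable [DecidableEq V]

/-- A walk is connected, so it visits at most one more vertex than it has distinct edges. -/
theorem card_vertices_le_card_edges_add_one (w : Fin (N + 1) → V) :
    (Finset.univ.image w).card ≤ (Finset.univ.image (walkEdge w)).card + 1 := by
  induction N with
  | zero => exact Finset.card_image_le
  | succ N ih =>
    have hv : Finset.univ.image w = insert (w 0) (Finset.univ.image (Fin.tail w)) := by
      ext x; simp [Fin.exists_fin_succ, Fin.tail, eq_comm]
    have he : Finset.univ.image (walkEdge w) =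
        insert s(w 0, w 1) (Finset.univ.image (walkEdge (Fin.tail w))) := by
      ext x; simp [Fin.exists_fin_succ, Fin.tail, walkEdge, eq_comm]
    rw [hv, he]
    have := ih (Fin.tail w)
    by_cases h0 : w 0 ∈ Finset.univ.image (Fin.tail w)
    · rw [Finset.insert_eq_of_mem h0]
      have := Finset.card_le_card
        (Finset.subset_insert s(w 0, w 1) (Finset.univ.image (walkEdge (Fin.tail w))))
      omega
    · have h1 : s(w 0, w 1) ∉ Finset.univ.image (walkEdge (Fin.tail w)) := by
        intro h
        obtain ⟨l, -, hl⟩ := Finset.mem_image.1 h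
        have : w 0 ∈ walkEdge (Fin.tail w) l := by rw [hl]; exact Sym2.mem_mk_left _ _
        rcases Sym2.mem_iff.1 this with h | h
        · exact h0 (Finset.mem_image.2 ⟨_, Finset.mem_univ _, h.symm⟩)
        · exact h0 (Finset.mem_image.2 ⟨_, Finset.mem_univ _, h.symm⟩)
      rw [Finset.card_insert_of_notMem h0, Finset.card_insert_of_notMem h1]
      omega

theorem RepeatsEdges.two_mul_card_edges_le {w : Fin (N + 1) → V} (hw : RepeatsEdges w) :
    2 * (Finset.univ.image (walkEdge w)).card ≤ N := by
  have h := Finset.card_nsmul_le_sum (Finset.univ.image (walkEdge w))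
    (fun e => (Finset.univ.filter fun l => walkEdge w l = e).card) 2 (fun e he => by
      obtain ⟨l, -, rfl⟩ := Finset.mem_image.1 he
      obtain ⟨l', h1, h2⟩ := hw l
      exact Finset.one_lt_card.2 ⟨l', by simp [h2], l, by simp, h1⟩)
  rw [← Finset.card_eq_sum_card_image, Finset.card_univ, Fintype.card_fin, smul_eq_mul] at h
  omega

/-- The number of times that the walk traverses the edge `e`. -/
def edgeCount (w : Fin (N + 1) → V) (e : Sym2 V) : ℕ :=
  (Finset.univ.filter fun l => walkEdge w l = e).card

theorem prod_walkEdge [Fintype V] (w : Fin (N + 1) → V) (f : Sym2 V → ℝ) :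
    ∏ l, f (walkEdge w l) = ∏ e, f e ^ edgeCount w e := by
  rw [← Finset.prod_fiberwise' Finset.univ (walkEdge w) f]
  simp [edgeCount]

theorem edgeCount_eq_zero_iff (w : Fin (N + 1) → V) (e : Sym2 V) :
    edgeCount w e = 0 ↔ e ∉ Finset.univ.image (walkEdge w) := by
  simp [edgeCount, Finset.filter_eq_empty_iff]

theorem repeatsEdges_iff (w : Fin (N + 1) → V) : RepeatsEdges w ↔ ∀ e, edgeCount w e ≠ 1 := by
  constructor
  · intro h e he
    obtain ⟨l, hl⟩ := Finset.card_eq_one.1 he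
    have h1 : walkEdge w l = e := by
      have : l ∈ Finset.univ.filter fun l => walkEdge w l = e := by rw [hl]; simp
      simpa using this
    obtain ⟨l', h2, h3⟩ := h l
    have : l' ∈ Finset.univ.filter fun l => walkEdge w l = e := by simp [h3, h1]
    rw [hl] at this
    exact h2 (by simpa using this)
  · intro h l
    by_contra! hl
    refine h (walkEdge w l) (Finset.card_eq_one.2 ⟨l, ?_⟩)
    ext l'
    simp only [Finset.mem_filter, Finset.mem_univ, true_and, Finset.mem_singleton]
    exact ⟨fun h' => by by_contra h2; exact hl l' h2 h', fun h' => by rw [h']⟩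

theorem prod_moments_eq_zero [Fintype V] {w : Fin (N + 1) → V} (hw : ¬ RepeatsEdges w)
    {μ : Sym2 V → ℕ → ℝ}
    (h1 : ∀ e, μ e 1 = 0) : ∏ e, μ e (edgeCount w e) = 0 := by
  rw [repeatsEdges_iff] at hw
  push Not at hw
  obtain ⟨e, he⟩ := hw
  exact Finset.prod_eq_zero (Finset.mem_univ e) (by rw [he, h1])

/-- Each traversed edge contributes a factor at most `p`, and there are at least as many of them
as there are vertices besides the first one. -/
theorem prod_moments_le [Fintype V] {w : Fin (N + 1) → V} (hw : RepeatsEdges w)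
    {μ : Sym2 V → ℕ → ℝ} {p : ℝ}
    (hp0 : 0 ≤ p) (hp1 : p ≤ 1) (h0 : ∀ e, μ e 0 = 1) (h2 : ∀ e, ∀ k, 2 ≤ k → |μ e k| ≤ p) :
    ∏ e, μ e (edgeCount w e) ≤ p ^ ((Finset.univ.image w).card - 1) := by
  refine (le_abs_self _).trans ?_
  rw [Finset.abs_prod, ← Finset.prod_subset (Finset.subset_univ (Finset.univ.image (walkEdge w)))
    (fun e _ he => by rw [(edgeCount_eq_zero_iff w e).2 he, h0, abs_one])]
  calc _ ≤ ∏ _e ∈ Finset.univ.image (walkEdge w), p := by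
        refine Finset.prod_le_prod (fun _ _ => abs_nonneg _) fun e he => h2 e _ ?_
        have h3 := (repeatsEdges_iff w).1 hw e
        have h4 := mt (edgeCount_eq_zero_iff w e).1 (not_not.2 he)
        omega
    _ = p ^ (Finset.univ.image (walkEdge w)).card := Finset.prod_const _
    _ ≤ _ := pow_le_pow_of_le_one hp0 hp1 (by have := card_vertices_le_card_edges_add_one w; omega)

theorem one_le_prod_moments [Fintype V] {w : Fin (N + 1) → V} (hw : RepeatsEdges w)
    {μ : Sym2 V → ℕ → ℝ}
    (h0 : ∀ e, μ e 0 = 1) (h2 : ∀ e, ∀ k, 2 ≤ k → 1 ≤ μ e k) :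
    1 ≤ ∏ e, μ e (edgeCount w e) := by
  rw [← Finset.prod_const_one (s := Finset.univ (α := Sym2 V))]
  refine Finset.prod_le_prod (fun _ _ => zero_le_one) fun e _ => ?_
  have h3 := (repeatsEdges_iff w).1 hw e
  rcases Nat.eq_zero_or_pos (edgeCount w e) with h | h
  · rw [h, h0]
  · exact h2 e _ (by omega)

end Walks

section Shapes

variable {I V R : Type*}

/-- Labelings of a given shape are injections of its set of classes. -/
def kerEqEquivEmbedding (s : Setoid I) : {w : I → V // Setoid.ker w = s} ≃ (Quotient s ↪ V) where
  toFun w := ⟨Quotient.lift w.1 fun a b h => by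
      have h' : s a b := h
      rwa [← w.2, Setoid.ker_def] at h', by
      intro a b
      induction a using Quotient.inductionOn
      induction b using Quotient.inductionOn
      intro h
      refine Quotient.sound ?_
      change s _ _
      rw [← w.2, Setoid.ker_def]
      exact h⟩
  invFun f := ⟨fun i => f (Quotient.mk s i), by
    ext a b
    rw [Setoid.ker_def, f.injective.eq_iff, Quotient.eq]⟩
  left_inv w := rfl
  right_inv f := by
    ext a
    induction a using Quotient.inductionOn
    rfl

theorem card_filter_ker_eq [DecidableEq I] [Fintype I] [Fintype V] (s : Setoid I)
    [DecidablePred fun w : I → V => Setoid.ker w = s] [Fintype (Quotient s)] :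
    (Finset.univ.filter fun w : I → V => Setoid.ker w = s).card =
      (Fintype.card V).descFactorial (Fintype.card (Quotient s)) := by
  classical
  rw [← Fintype.card_embedding_eq, ← Fintype.card_congr (kerEqEquivEmbedding (V := V) s),
    Fintype.card_subtype]

open Classical in
theorem card_image_eq_card_quotient_ker [Fintype I] [DecidableEq V] (w : I → V) :
    (Finset.univ.image w).card = Fintype.card (Quotient (Setoid.ker w)) := by
  rw [Fintype.card_congr (Setoid.quotientKerEquivRange w), ← Set.toFinset_card]
  congr 1
  ext; simp

theorem descFactorial_mul_pow_le {m r q u : ℕ} {p : ℝ} (hp : 0 ≤ p) (h : m * p + q ≤ r)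
    (hu : u ≤ q) :
    r * (m.descFactorial (u + 1) * p ^ u) ≤ m * (r.descFactorial (u + 1) : ℝ) := by
  rcases Nat.eq_zero_or_pos r with rfl | hr
  · simp
  obtain ⟨r, rfl⟩ := Nat.exists_eq_succ_of_ne_zero hr.ne'
  have h1 : (m.descFactorial (u + 1) : ℝ) ≤ m ^ (u + 1) := by
    exact_mod_cast Nat.descFactorial_le_pow m (u + 1)
  have h2 : ((r + 1 - u : ℕ) : ℝ) ^ u ≤ r.descFactorial u := by
    exact_mod_cast Nat.pow_sub_le_descFactorial r u
  have hqr : (q : ℝ) ≤ (r + 1 : ℕ) := by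
    have : 0 ≤ m * p := by positivity
    simp only [Nat.succ_eq_add_one] at h
    linarith
  have hqr' : q ≤ r + 1 := by exact_mod_cast hqr
  have h3 : m * p ≤ ((r + 1 - u : ℕ) : ℝ) := by
    rw [Nat.cast_sub (hu.trans hqr')]
    have : (u : ℝ) ≤ q := by exact_mod_cast hu
    simp only [Nat.succ_eq_add_one] at h
    linarith
  rw [Nat.succ_eq_add_one, Nat.succ_descFactorial_succ]
  push_cast
  calc ((r : ℝ) + 1) * (m.descFactorial (u + 1) * p ^ u)
      ≤ (r + 1) * (m ^ (u + 1) * p ^ u) := by gcongr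
    _ = m * ((r + 1) * (m * p) ^ u) := by ring
    _ ≤ m * ((r + 1) * ((r + 1 - u : ℕ) : ℝ) ^ u) := by gcongr
    _ ≤ _ := by gcongr

open Classical in
/-- The weighted number of repeating closed walks in `V` is compared, shape by shape, with the
number of such walks in a smaller set `R`. A shape with `v` classes has at most `|V| ^ v`
realizations in `V` and at least `|R| (|R| - q) ^ (v - 1)` in `R`. -/
theorem sum_repeatingClosedWalk_le [Fintype V] [DecidableEq V] [Fintype R] (q : ℕ)
    {p : ℝ} (hp : 0 ≤ p)
    (h : Fintype.card V * p + q ≤ Fintype.card R) :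
    Fintype.card R * ∑ w : Fin (2 * q + 1) → V,
      (if IsRepeatingClosedWalk w then p ^ ((Finset.univ.image w).card - 1) else 0) ≤
    Fintype.card V * ∑ w : Fin (2 * q + 1) → R,
      (if IsRepeatingClosedWalk w then (1 : ℝ) else 0) := by
  have : Finite (Setoid (Fin (2 * q + 1))) := Finite.of_injective
    (fun s : Setoid (Fin (2 * q + 1)) => (fun a b => s a b)) fun s t hst => by
      ext a b; exact iff_of_eq (congrFun (congrFun hst a) b)
  have := Fintype.ofFinite (Setoid (Fin (2 * q + 1)))
  rw [← Finset.sum_fiberwise Finset.univ (fun w : Fin (2 * q + 1) → V => Setoid.ker w),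
    ← Finset.sum_fiberwise Finset.univ (fun w : Fin (2 * q + 1) → R => Setoid.ker w),
    Finset.mul_sum, Finset.mul_sum]
  refine Finset.sum_le_sum fun s _ => ?_
  have hs : Setoid.ker (Quotient.mk s) = s := by ext a b; rw [Setoid.ker_def, Quotient.eq]
  by_cases hg : IsRepeatingClosedWalk (Quotient.mk s)
  · have hV : ∀ w ∈ Finset.univ.filter (fun w : Fin (2 * q + 1) → V => Setoid.ker w = s),
        (if IsRepeatingClosedWalk w then p ^ ((Finset.univ.image w).card - 1) else 0) =
          p ^ (Fintype.card (Quotient s) - 1) := fun w hw => by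
      have hw' := (Finset.mem_filter.1 hw).2
      rw [if_pos (isRepeatingClosedWalk_of_ker_eq (hs.trans hw'.symm) hg),
        card_image_eq_card_quotient_ker]
      subst hw'
      congr!
    have hR : ∀ w ∈ Finset.univ.filter (fun w : Fin (2 * q + 1) → R => Setoid.ker w = s),
        (if IsRepeatingClosedWalk w then (1 : ℝ) else 0) = 1 := fun w hw => by
      have hw' := (Finset.mem_filter.1 hw).2
      rw [if_pos (isRepeatingClosedWalk_of_ker_eq (hs.trans hw'.symm) hg)]
    rw [Finset.sum_congr rfl hV, Finset.sum_congr rfl hR, Finset.sum_const, Finset.sum_const,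
      card_filter_ker_eq, card_filter_ker_eq]
    have h1 : 0 < Fintype.card (Quotient s) := Fintype.card_pos_iff.2 ⟨Quotient.mk s 0⟩
    have h2 : Fintype.card (Quotient s) ≤ q + 1 := by
      have h3 := card_vertices_le_card_edges_add_one (Quotient.mk s)
      have h4 := hg.2.two_mul_card_edges_le
      have h5 : (Finset.univ.image (Quotient.mk s)).card = Fintype.card (Quotient s) := by
        rw [Finset.image_univ_of_surjective Quotient.mk_surjective, Finset.card_univ]
      omega
    obtain ⟨u, hu⟩ := Nat.exists_eq_add_of_le' h1
    simp only [nsmul_eq_mul, mul_one]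
    rw [hu, Nat.add_sub_cancel]
    exact descFactorial_mul_pow_le hp h (by omega)
  · rw [Finset.sum_eq_zero, Finset.sum_eq_zero]
    · simp
    · intro w hw
      exact if_neg fun h' =>
        hg (isRepeatingClosedWalk_of_ker_eq ((Finset.mem_filter.1 hw).2.trans hs.symm) h')
    · intro w hw
      exact if_neg fun h' =>
        hg (isRepeatingClosedWalk_of_ker_eq ((Finset.mem_filter.1 hw).2.trans hs.symm) h')

end Shapes

/-! ### A comparison matrix with independent entries -/

section Comparison

open scoped Matrix.Norms.L2Operator

variable {R : Type*}

/-- The values, taken with probability `1 / 3` each, of a centred random variable all of whose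
moments of order at least two are at least one. -/
def skewSign : Fin 3 → ℝ := ![2, -1, -1]

/-- The symmetric matrix whose entry on the edge `e` is the value of `skewSign` at `f e`. For
uniformly distributed `f` its entries on distinct edges are independent. -/
def skewMatrix (f : Sym2 R → Fin 3) : Matrix R R ℝ :=
  Matrix.of fun i j => skewSign (f s(i, j))

theorem skewMatrix_isSymm (f : Sym2 R → Fin 3) : (skewMatrix f).IsSymm := by
  ext i j
  simp [skewMatrix, Sym2.eq_swap]

theorem one_le_moment_skewSign {k : ℕ} (hk : 2 ≤ k) : 1 ≤ (∑ a, skewSign a ^ k) / 3 := by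
  have h2 : (2 : ℝ) ^ k ≥ 4 := by
    calc (2 : ℝ) ^ k ≥ 2 ^ 2 := pow_le_pow_right₀ (by norm_num) hk
      _ = 4 := by norm_num
  simp only [skewSign, Fin.sum_univ_three, Matrix.cons_val_zero, Matrix.cons_val_one,
    Matrix.cons_val]
  rcases Nat.even_or_odd k with h | h
  · rw [h.neg_one_pow]; linarith
  · rw [h.neg_one_pow]
    have h3 : 3 ≤ k := by
      rcases h with ⟨j, rfl⟩; omega
    have : (2 : ℝ) ^ k ≥ 8 := by
      calc (2 : ℝ) ^ k ≥ 2 ^ 3 := pow_le_pow_right₀ (by norm_num) h3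
        _ = 8 := by norm_num
    linarith

theorem exp_le_add_exp_sq (u : ℝ) : Real.exp u ≤ u + Real.exp (u ^ 2) := by
  have h1 := Real.add_one_le_exp (u ^ 2)
  rcases le_total |u| 1 with h | h
  · have := (abs_le.1 (Real.abs_exp_sub_one_sub_id_le h)).2
    linarith
  · rcases le_abs'.1 h with h | h
    · have : Real.exp u ≤ 1 := Real.exp_le_one_iff.2 (by linarith)
      nlinarith
    · have : Real.exp u ≤ Real.exp (u ^ 2) := Real.exp_le_exp.2 (by nlinarith)
      linarith

theorem sum_exp_mul_skewSign_le (t : ℝ) :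
    ∑ a, Real.exp (t * skewSign a) ≤ 3 * Real.exp (4 * t ^ 2) := by
  have h : ∀ a, Real.exp (t * skewSign a) ≤ t * skewSign a + Real.exp (4 * t ^ 2) := fun a => by
    refine (exp_le_add_exp_sq _).trans ?_
    gcongr
    rw [mul_pow, mul_comm]
    gcongr
    fin_cases a <;> norm_num [skewSign]
  refine (Finset.sum_le_sum fun a _ => h a).trans (le_of_eq ?_)
  simp [Fin.sum_univ_three, skewSign]
  ring

variable [Fintype R] [DecidableEq R]

open Classical in
/-- Repeating closed walks contribute at least one to the trace moments of the comparison matrix,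
and the remaining walks do not contribute. Expectations are written as sums over all `f`, so that the
number of functions `f` appears as a factor. -/
theorem card_repeatingClosedWalk_le_sum_trace (N : ℕ) :
    3 ^ Fintype.card (Sym2 R) *
      ∑ w : Fin (N + 1) → R, (if IsRepeatingClosedWalk w then (1 : ℝ) else 0) ≤
    ∑ f : Sym2 R → Fin 3, (skewMatrix f ^ N).trace := by
  simp_rw [Matrix.trace_pow_eq_sum_walk]
  rw [Finset.sum_comm, Finset.mul_sum]
  refine Finset.sum_le_sum fun w _ => ?_
  by_cases hc : w 0 = w (Fin.last N)
  swap
  · simp [hc, IsRepeatingClosedWalk]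
  let μ : Sym2 R → ℕ → ℝ := fun _ k => (∑ a, skewSign a ^ k) / 3
  have h0 : ∀ e, μ e 0 = 1 := fun e => by simp [μ]
  have h1 : ∀ e, μ e 1 = 0 := fun e => by
    simp [μ, skewSign, Fin.sum_univ_three]
    norm_num
  have key : ∑ f : Sym2 R → Fin 3, ∏ l : Fin N, skewMatrix f (w l.castSucc) (w l.succ) =
      3 ^ Fintype.card (Sym2 R) * ∏ e, μ e (edgeCount w e) := by
    have : ∀ f : Sym2 R → Fin 3, ∏ l : Fin N, skewMatrix f (w l.castSucc) (w l.succ) =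
        ∏ e, skewSign (f e) ^ edgeCount w e := fun f =>
      prod_walkEdge w fun e => skewSign (f e)
    simp_rw [this]
    rw [← Fintype.piFinset_univ, ← Finset.prod_univ_sum (fun _ : Sym2 R => Finset.univ)
      (fun e a => skewSign a ^ edgeCount w e)]
    simp only [μ, Finset.prod_div_distrib, Finset.prod_const, Finset.card_univ]
    field_simp
  simp only [hc, if_true, key]
  by_cases hr : RepeatsEdges w
  · rw [if_pos ⟨hc, hr⟩]
    gcongr
    exact one_le_prod_moments hr h0 fun e k hk => one_le_moment_skewSign hk
  · rw [if_neg fun h => hr h.2, prod_moments_eq_zero hr h1]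

/-- A sub-Gaussian bound for bilinear forms in the comparison matrix. -/
theorem sum_exp_bilin_skewMatrix_le (x y : R → ℝ) :
    ∑ f : Sym2 R → Fin 3, Real.exp (∑ i, ∑ j, x i * skewMatrix f i j * y j) ≤
      3 ^ Fintype.card (Sym2 R) * Real.exp (8 * ((∑ i, x i ^ 2) * ∑ j, y j ^ 2)) := by
  let F : Sym2 R → Finset (R × R) := fun e => Finset.univ.filter fun z => s(z.1, z.2) = e
  let a : Sym2 R → ℝ := fun e => ∑ z ∈ F e, x z.1 * y z.2
  have hsum : ∀ f : Sym2 R → Fin 3, ∑ i, ∑ j, x i * skewMatrix f i j * y j =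
      ∑ e, a e * skewSign (f e) := fun f => by
    rw [← Fintype.sum_prod_type' fun i j => x i * skewMatrix f i j * y j,
      ← Finset.sum_fiberwise Finset.univ fun z : R × R => s(z.1, z.2)]
    refine Finset.sum_congr rfl fun e _ => ?_
    rw [Finset.sum_mul]
    refine Finset.sum_congr rfl fun z hz => ?_
    rw [← (Finset.mem_filter.1 hz).2]
    simp only [skewMatrix, Matrix.of_apply]
    ring
  have hcard : ∀ e, (F e).card ≤ 2 := fun e => by
    induction e using Sym2.ind with
    | _ u v =>
      refine (Finset.card_le_card (t := {(u, v), (v, u)}) fun z hz => ?_).trans Finset.card_le_two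
      have := (Finset.mem_filter.1 hz).2
      simp only [Sym2.eq_iff] at this
      rcases this with ⟨h1, h2⟩ | ⟨h1, h2⟩ <;> simp [← h1, ← h2]
  have hasq : ∑ e, a e ^ 2 ≤ 2 * ((∑ i, x i ^ 2) * ∑ j, y j ^ 2) := by
    calc ∑ e, a e ^ 2 ≤ ∑ e, 2 * ∑ z ∈ F e, (x z.1 * y z.2) ^ 2 := by
          refine Finset.sum_le_sum fun e _ => ?_
          refine (sq_sum_le_card_mul_sum_sq).trans ?_
          gcongr
          exact_mod_cast hcard e
      _ = 2 * ∑ z : R × R, (x z.1 * y z.2) ^ 2 := by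
          rw [← Finset.mul_sum, Finset.sum_fiberwise]
      _ = _ := by
          rw [Fintype.sum_prod_type, Finset.sum_mul_sum]
          simp_rw [mul_pow]
  simp_rw [hsum, Real.exp_sum]
  rw [← Fintype.piFinset_univ, ← Finset.prod_univ_sum (fun _ : Sym2 R => Finset.univ)
    (fun e b => Real.exp (a e * skewSign b))]
  calc _ ≤ ∏ e, 3 * Real.exp (4 * a e ^ 2) :=
        Finset.prod_le_prod (fun _ _ => by positivity) fun e _ => sum_exp_mul_skewSign_le _
    _ = 3 ^ Fintype.card (Sym2 R) * Real.exp (4 * ∑ e, a e ^ 2) := by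
        rw [Finset.prod_mul_distrib, Finset.prod_const, Finset.card_univ, ← Real.exp_sum,
          Finset.mul_sum]
    _ ≤ _ := mul_le_mul_of_nonneg_left (Real.exp_le_exp.2 (by linarith)) (by positivity)

end Comparison

/-! ### A lattice net of the Euclidean ball -/

section Net

open scoped Matrix.Norms.L2Operator

theorem sum_Icc_half_pow_natAbs (M : ℕ) :
    ∑ k ∈ Finset.Icc (-(M : ℤ)) M, (1 / 2 : ℝ) ^ k.natAbs = 3 - 2 * (1 / 2) ^ M := by
  induction M with
  | zero => norm_num
  | succ M ih =>
    have h : Finset.Icc (-((M + 1 : ℕ) : ℤ)) (M + 1 : ℕ) =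
        insert (-((M + 1 : ℕ) : ℤ)) (insert ((M + 1 : ℕ) : ℤ) (Finset.Icc (-(M : ℤ)) M)) := by
      ext k; simp only [Finset.mem_Icc, Finset.mem_insert]; omega
    rw [h, Finset.sum_insert, Finset.sum_insert, ih, Int.natAbs_neg, Int.natAbs_natCast, pow_succ]
    · ring
    · simp
    · simp only [Finset.mem_Icc, Finset.mem_insert]; omega

variable (R : Type*) [Fintype R] [DecidableEq R]

/-- The integer vectors of squared length at most `25 r`, where `r` is the dimension. The box in the
definition only serves to exhibit a finite set. -/
noncomputable def latticeNet : Finset (R → ℤ) :=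
  (Fintype.piFinset fun _ =>
    Finset.Icc (-((5 * Fintype.card R : ℕ) : ℤ)) (5 * Fintype.card R : ℕ)).filter fun z =>
      ∑ i, z i ^ 2 ≤ 25 * Fintype.card R

theorem mem_latticeNet {z : R → ℤ} : z ∈ latticeNet R ↔ ∑ i, z i ^ 2 ≤ 25 * Fintype.card R := by
  simp only [latticeNet, Finset.mem_filter, Fintype.mem_piFinset, Finset.mem_Icc,
    and_iff_right_iff_imp]
  intro h i
  have h1 : z i ^ 2 ≤ 25 * Fintype.card R :=
    (Finset.single_le_sum (f := fun i => z i ^ 2) (fun i _ => sq_nonneg _)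
      (Finset.mem_univ i)).trans h
  have h2 : (1 : ℤ) ≤ Fintype.card R := by
    exact_mod_cast Fintype.card_pos_iff.2 ⟨i⟩
  have h3 : z i ^ 2 ≤ (5 * Fintype.card R : ℤ) ^ 2 := by nlinarith
  have := abs_le.1 (abs_le_of_sq_le_sq h3 (by positivity))
  push_cast
  exact this

/-- The size of the net is exponential in the dimension. -/
theorem card_latticeNet_le : ((latticeNet R).card : ℝ) ≤ Real.exp (27 * Fintype.card R) := by
  have h3 : (3 : ℝ) ≤ Real.exp 2 := by have := Real.add_one_le_exp (2 : ℝ); linarith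
  set M := 5 * Fintype.card R
  have hk : ∀ k : ℤ, Real.exp (-(k : ℝ) ^ 2) ≤ (1 / 2 : ℝ) ^ k.natAbs := fun k => by
    have h1 : Real.exp (-1) ≤ 1 / 2 := by
      rw [Real.exp_neg, inv_eq_one_div]
      have := Real.add_one_le_exp (1 : ℝ)
      gcongr; linarith
    calc Real.exp (-(k : ℝ) ^ 2) ≤ Real.exp (k.natAbs * (-1)) := by
          gcongr
          have : (k.natAbs : ℝ) ≤ (k.natAbs : ℝ) ^ 2 := by
            exact_mod_cast Nat.le_self_pow two_ne_zero _
          have h4 : (k.natAbs : ℝ) ^ 2 = (k : ℝ) ^ 2 := by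
            rw [Nat.cast_natAbs, Int.cast_abs, sq_abs]
          linarith
      _ = Real.exp (-1) ^ k.natAbs := Real.exp_nat_mul _ _
      _ ≤ _ := by gcongr
  calc ((latticeNet R).card : ℝ) = ∑ _z ∈ latticeNet R, (1 : ℝ) := by simp
    _ ≤ ∑ z ∈ latticeNet R, Real.exp (25 * Fintype.card R) * ∏ i, Real.exp (-(z i : ℝ) ^ 2) := by
        refine Finset.sum_le_sum fun z hz => ?_
        rw [← Real.exp_sum, ← Real.exp_add, Real.one_le_exp_iff, Finset.sum_neg_distrib]
        have : ((∑ i, z i ^ 2 : ℤ) : ℝ) ≤ ((25 * Fintype.card R : ℤ) : ℝ) := by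
          exact_mod_cast (mem_latticeNet R).1 hz
        push_cast at this
        linarith
    _ ≤ ∑ z ∈ Fintype.piFinset fun _ : R => Finset.Icc (-(M : ℤ)) M,
          Real.exp (25 * Fintype.card R) * ∏ i, Real.exp (-(z i : ℝ) ^ 2) :=
        Finset.sum_le_sum_of_subset_of_nonneg (Finset.filter_subset _ _)
          fun _ _ _ => by positivity
    _ = Real.exp (25 * Fintype.card R) *
          ∏ _i : R, ∑ k ∈ Finset.Icc (-(M : ℤ)) M, Real.exp (-(k : ℝ) ^ 2) := by
        rw [← Finset.mul_sum, Finset.prod_univ_sum]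
    _ ≤ Real.exp (25 * Fintype.card R) * ∏ _i : R, Real.exp 2 := by
        gcongr with i
        refine (Finset.sum_le_sum fun k _ => hk k).trans ?_
        rw [sum_Icc_half_pow_natAbs]
        have : (0 : ℝ) < (1 / 2) ^ M := by positivity
        linarith
    _ = Real.exp (27 * Fintype.card R) := by
        rw [Finset.prod_const, Finset.card_univ, ← Real.exp_nat_mul, ← Real.exp_add]
        ring_nf

variable {R}

/-- The net point of an integer vector: the lattice has mesh `1 / (4 √r)`. -/
noncomputable def netPoint (z : R → ℤ) : EuclideanSpace ℝ R :=
  WithLp.toLp 2 fun i => (z i : ℝ) / (4 * √(Fintype.card R))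

theorem norm_netPoint_le {z : R → ℤ} (hz : z ∈ latticeNet R) : ‖netPoint z‖ ≤ 5 / 4 := by
  refine le_of_sq_le_sq ?_ (by norm_num)
  have h : ((∑ i, z i ^ 2 : ℤ) : ℝ) ≤ ((25 * Fintype.card R : ℤ) : ℝ) := by
    exact_mod_cast (mem_latticeNet R).1 hz
  push_cast at h
  rw [EuclideanSpace.real_norm_sq_eq]
  simp only [netPoint, div_pow, mul_pow, Real.sq_sqrt (Nat.cast_nonneg _)]
  rw [← Finset.sum_div]
  refine div_le_of_le_mul₀ (by positivity) (by norm_num) ?_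
  linarith

theorem exists_netPoint_near (x : EuclideanSpace ℝ R) (hx : ‖x‖ ≤ 1) :
    ∃ z ∈ latticeNet R, ‖x - netPoint z‖ ≤ 1 / 4 := by
  rcases isEmpty_or_nonempty R with hR | hR
  · refine ⟨0, by simp [mem_latticeNet], ?_⟩
    rw [Subsingleton.elim (x - netPoint 0) 0]
    simp
  have hr : (0 : ℝ) < Fintype.card R := by exact_mod_cast Fintype.card_pos
  set s : ℝ := 4 * √(Fintype.card R) with hs
  have hs0 : 0 < s := by positivity
  have hs2 : s ^ 2 = 16 * Fintype.card R := by
    rw [hs, mul_pow, Real.sq_sqrt hr.le]; norm_num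
  set z : R → ℤ := fun i => ⌊x i * s⌋ with hz
  have hnear : ‖x - netPoint z‖ ≤ 1 / 4 := by
    refine le_of_sq_le_sq ?_ (by norm_num)
    rw [EuclideanSpace.real_norm_sq_eq]
    calc ∑ i, (x - netPoint z) i ^ 2 ≤ ∑ _i : R, 1 / s ^ 2 := by
          refine Finset.sum_le_sum fun i _ => ?_
          have h1 : (x - netPoint z) i = Int.fract (x i * s) / s := by
            simp only [PiLp.sub_apply, netPoint, ← hs, hz, Int.fract]
            field_simp
          rw [h1, div_pow]
          gcongr
          exact pow_le_one₀ (Int.fract_nonneg _) (Int.fract_lt_one _).le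
      _ = (1 / 4) ^ 2 := by
          rw [Finset.sum_const, Finset.card_univ, hs2, nsmul_eq_mul]
          field_simp; norm_num
  refine ⟨z, ?_, hnear⟩
  have h1 : ‖netPoint z‖ ≤ 5 / 4 := by
    have := norm_sub_le x (x - netPoint z)
    rw [sub_sub_cancel] at this
    linarith
  have h2 := pow_le_pow_left₀ (norm_nonneg _) h1 2
  rw [EuclideanSpace.real_norm_sq_eq] at h2
  simp only [netPoint, div_pow, ← hs, hs2] at h2
  rw [← Finset.sum_div, div_le_iff₀ (by positivity)] at h2
  rw [mem_latticeNet]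
  have : ((∑ i, z i ^ 2 : ℤ) : ℝ) ≤ ((25 * Fintype.card R : ℤ) : ℝ) := by
    push_cast
    linarith
  exact_mod_cast this

/-- The operator norm is attained up to a constant on pairs of net points. -/
theorem exists_netPoint_l2_opNorm_le (M : Matrix R R ℝ) :
    ∃ z ∈ latticeNet R ×ˢ latticeNet R,
      ‖M‖ ≤ 3 * ∑ i, ∑ j, netPoint z.1 i * M i j * netPoint z.2 j := by
  have hne : (latticeNet R ×ˢ latticeNet R).Nonempty := ⟨(0, 0), by simp [mem_latticeNet]⟩
  obtain ⟨z, hz, hmax⟩ := Finset.exists_max_image _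
    (fun z => ∑ i, ∑ j, netPoint z.1 i * M i j * netPoint z.2 j) hne
  refine ⟨z, hz, ?_⟩
  set β := ∑ i, ∑ j, netPoint z.1 i * M i j * netPoint z.2 j
  set T := Matrix.toEuclideanCLM (n := R) (𝕜 := ℝ) M with hT
  have hTM : ‖T‖ = ‖M‖ := Matrix.l2_opNorm_toEuclideanCLM M
  have hin : ∀ x y : EuclideanSpace ℝ R, inner ℝ x (T y) = ∑ i, ∑ j, x i * M i j * y j :=
    fun x y => by
      rw [hT, Matrix.inner_toEuclideanCLM, dotProduct]
      simp [Matrix.mulVec, dotProduct, Finset.mul_sum, mul_assoc]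
  have hβ0 : 0 ≤ β := by
    have := hmax (0, 0) (by simp [mem_latticeNet])
    simpa [netPoint] using this
  have hb : ∀ x y : EuclideanSpace ℝ R, ‖x‖ ≤ 1 → ‖y‖ ≤ 1 →
      inner ℝ x (T y) ≤ β + 9 / 16 * ‖M‖ := fun x y hx hy => by
    obtain ⟨u, hu, hxu⟩ := exists_netPoint_near x hx
    obtain ⟨v, hv, hyv⟩ := exists_netPoint_near y hy
    have e : inner ℝ x (T y) = inner ℝ (netPoint u) (T (netPoint v)) +
        inner ℝ (x - netPoint u) (T y) + inner ℝ (netPoint u) (T (y - netPoint v)) := by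
      rw [map_sub, inner_sub_left, inner_sub_right]; ring
    have h1 : inner ℝ (netPoint u) (T (netPoint v)) ≤ β := by
      rw [hin]; exact hmax (u, v) (Finset.mk_mem_product hu hv)
    have h2 : inner ℝ (x - netPoint u) (T y) ≤ 1 / 4 * (‖M‖ * 1) := by
      refine (real_inner_le_norm _ _).trans ?_
      gcongr
      exact (T.le_opNorm y).trans (by rw [hTM]; gcongr)
    have h3 : inner ℝ (netPoint u) (T (y - netPoint v)) ≤ 5 / 4 * (‖M‖ * (1 / 4)) := by
      refine (real_inner_le_norm _ _).trans ?_
      gcongr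
      · exact norm_netPoint_le hu
      · exact (T.le_opNorm _).trans (by rw [hTM]; gcongr)
    rw [e]
    linarith
  have hN : ‖T‖ ≤ β + 9 / 16 * ‖M‖ := by
    refine ContinuousLinearMap.opNorm_le_of_unit_norm (by positivity) fun y hy => ?_
    rcases eq_or_ne (T y) 0 with h | h
    · rw [h, norm_zero]; positivity
    have h0 : 0 < ‖T y‖ := norm_pos_iff.2 h
    have := hb (‖T y‖⁻¹ • T y) y (by rw [norm_smul, norm_inv, norm_norm, inv_mul_cancel₀ h0.ne'])
      hy.le
    rw [real_inner_smul_left, real_inner_self_eq_norm_sq] at this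
    have h2 : ‖T y‖⁻¹ * ‖T y‖ ^ 2 = ‖T y‖ := by field_simp
    rwa [h2] at this
  rw [hTM] at hN
  linarith [norm_nonneg M]

/-- The moments of order `2 q`, `q ≤ r`, of the operator norm of the comparison matrix of
dimension `r` are as if the norm were `O(√r)`. -/
theorem sum_l2_opNorm_skewMatrix_pow_le [Nonempty R] {q : ℕ} (hq : q ≤ Fintype.card R) :
    ∑ f : Sym2 R → Fin 3, ‖skewMatrix f‖ ^ (2 * q) ≤
      3 ^ Fintype.card (Sym2 R) * (2 * (532 * √(Fintype.card R)) ^ (2 * q)) := by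
  set r : ℝ := (Fintype.card R : ℝ) with hr
  have hr0 : 0 < r := by rw [hr]; exact_mod_cast Fintype.card_pos
  have hqr : (q : ℝ) ≤ r := by rw [hr]; exact_mod_cast hq
  set S := √r with hS
  have hS0 : 0 < S := Real.sqrt_pos.2 hr0
  have hSr : S ^ 2 = r := Real.sq_sqrt hr0.le
  -- The bilinear form at a pair of net points, scaled for the exponential Markov inequality. The
  -- constants satisfy `56 = 54 + 2`, where `exp (54 r)` bounds the number of pairs and `exp (2 r)`
  -- their exponential moments; then `532 = 3 * 56 * 19 / 6` matches the scaling by `6 / 19`.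
  let g : (Sym2 R → Fin 3) → (R → ℤ) × (R → ℤ) → ℝ := fun f z =>
    ∑ i, ∑ j, (6 / 19 * S * netPoint z.1 i) * skewMatrix f i j * netPoint z.2 j
  have hpt : ∀ f : Sym2 R → Fin 3, ‖skewMatrix f‖ ^ (2 * q) ≤ (532 * S) ^ (2 * q) *
      (1 + ∑ z ∈ latticeNet R ×ˢ latticeNet R, Real.exp (-(56 * r)) * Real.exp (g f z)) :=
    fun f => by
      obtain ⟨z, hz, hle⟩ := exists_netPoint_l2_opNorm_le (skewMatrix f)
      set u := ‖skewMatrix f‖ / (532 * S) with hu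
      have hu0 : 0 ≤ u := by positivity
      have e : ‖skewMatrix f‖ = (532 * S) * u := by rw [hu]; field_simp
      rw [e, mul_pow]
      gcongr
      have hsum : Real.exp (-(56 * r)) * Real.exp (g f z) ≤
          ∑ z ∈ latticeNet R ×ˢ latticeNet R, Real.exp (-(56 * r)) * Real.exp (g f z) :=
        Finset.single_le_sum (f := fun z => Real.exp (-(56 * r)) * Real.exp (g f z))
          (fun _ _ => by positivity) hz
      have hg : g f z =
          6 / 19 * S * ∑ i, ∑ j, netPoint z.1 i * skewMatrix f i j * netPoint z.2 j := by
        simp only [g, Finset.mul_sum, mul_assoc]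
      have hexp : 56 * r * u ≤ g f z := by
        rw [hg, hu, ← hSr]
        have : 56 * S ^ 2 * (‖skewMatrix f‖ / (532 * S)) = 2 / 19 * S * ‖skewMatrix f‖ := by
          field_simp; ring
        rw [this]
        nlinarith
      refine le_trans ?_ (add_le_add_right hsum 1)
      -- `u ^ (2 q) ≤ 1 + exp (56 r (u - 1))`, by `u ≤ exp (u - 1)` if `u ≥ 1`.
      rcases le_total u 1 with h1 | h1
      · have := pow_le_one₀ (n := 2 * q) hu0 h1
        have : 0 < Real.exp (-(56 * r)) * Real.exp (g f z) := by positivity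
        linarith
      · have h2 : u ^ (2 * q) ≤ Real.exp ((2 * q : ℕ) * (u - 1)) := by
          rw [Real.exp_nat_mul]
          gcongr
          have := Real.add_one_le_exp (u - 1)
          linarith
        have h3 : Real.exp ((2 * q : ℕ) * (u - 1)) ≤ Real.exp (-(56 * r)) * Real.exp (g f z) := by
          rw [← Real.exp_add]
          gcongr
          push_cast
          nlinarith
        linarith
  have hmgf : ∀ z ∈ latticeNet R ×ˢ latticeNet R,
      ∑ f, Real.exp (g f z) ≤ 3 ^ Fintype.card (Sym2 R) * Real.exp (2 * r) := fun z hz => by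
    refine (sum_exp_bilin_skewMatrix_le _ _).trans
      (mul_le_mul_of_nonneg_left (Real.exp_le_exp.2 ?_) (by positivity))
    have h1 := pow_le_pow_left₀ (norm_nonneg _) (norm_netPoint_le (Finset.mem_product.1 hz).1) 2
    have h2 := pow_le_pow_left₀ (norm_nonneg _) (norm_netPoint_le (Finset.mem_product.1 hz).2) 2
    rw [EuclideanSpace.real_norm_sq_eq] at h1 h2
    simp_rw [mul_pow, ← Finset.mul_sum, hSr]
    calc _ ≤ 8 * ((6 / 19) ^ 2 * r * (5 / 4) ^ 2 * (5 / 4) ^ 2) := by gcongr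
      _ ≤ 2 * r := by linarith
  have hcard : ((latticeNet R ×ˢ latticeNet R).card : ℝ) ≤ Real.exp (54 * r) := by
    rw [Finset.card_product, Nat.cast_mul]
    calc _ ≤ Real.exp (27 * r) * Real.exp (27 * r) := by
          gcongr <;> exact card_latticeNet_le R
      _ = _ := by rw [← Real.exp_add]; ring_nf
  calc ∑ f, ‖skewMatrix f‖ ^ (2 * q)
      ≤ ∑ f : Sym2 R → Fin 3, (532 * S) ^ (2 * q) *
        (1 + ∑ z ∈ latticeNet R ×ˢ latticeNet R, Real.exp (-(56 * r)) * Real.exp (g f z)) :=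
        Finset.sum_le_sum fun f _ => hpt f
    _ = (532 * S) ^ (2 * q) * (3 ^ Fintype.card (Sym2 R) + Real.exp (-(56 * r)) *
        ∑ z ∈ latticeNet R ×ˢ latticeNet R, ∑ f, Real.exp (g f z)) := by
        rw [← Finset.mul_sum, Finset.sum_add_distrib, Finset.sum_comm (s := Finset.univ)]
        simp_rw [← Finset.mul_sum]
        simp
    _ ≤ (532 * S) ^ (2 * q) * (3 ^ Fintype.card (Sym2 R) + Real.exp (-(56 * r)) *
        (Real.exp (54 * r) * (3 ^ Fintype.card (Sym2 R) * Real.exp (2 * r)))) := by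
        gcongr
        refine (Finset.sum_le_sum hmgf).trans ?_
        rw [Finset.sum_const, nsmul_eq_mul]
        gcongr
    _ = _ := by
        have : Real.exp (-(56 * r)) * Real.exp (54 * r) * Real.exp (2 * r) = 1 := by
          rw [← Real.exp_add, ← Real.exp_add, ← Real.exp_zero]; ring_nf
        linear_combination (532 * S) ^ (2 * q) * 3 ^ Fintype.card (Sym2 R) * this

end Net

/-! ### The noise matrix of a Bernoulli graph -/

section Noise

open scoped Matrix.Norms.L2Operator

variable {n : ℕ}

/-- The off-diagonal part of `M - Θ`. For the adjacency matrix of a graph with edge probabilities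
`Θ` this is the deviation from its expectation. -/
def noiseMatrix (Θ M : Matrix (Fin n) (Fin n) ℝ) : Matrix (Fin n) (Fin n) ℝ :=
  Matrix.of fun i j => if i = j then 0 else M i j - Θ i j

theorem noiseMatrix_isSymm {Θ M : Matrix (Fin n) (Fin n) ℝ} (hΘ : ∀ i j, Θ i j = Θ j i)
    (hM : ∀ i j, M i j = M j i) : (noiseMatrix Θ M).IsSymm := by
  ext i j
  simp [noiseMatrix, eq_comm (a := j), hΘ j i, hM j i]

variable {Ω : Type*} [MeasurableSpace Ω] {P : Measure Ω}
  {Θ : Matrix (Fin n) (Fin n) ℝ} {A : Ω → Matrix (Fin n) (Fin n) ℝ} {p : ℝ}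

theorem IsBernoulliGraph.measurable_noiseMatrix (hA : IsBernoulliGraph P Θ A) (i j : Fin n) :
    Measurable fun ω => noiseMatrix Θ (A ω) i j := by
  by_cases h : i = j
  · simp [noiseMatrix, h]
  · simpa [noiseMatrix, h] using (hA.measurable_entry i j).sub_const _

theorem IsBernoulliGraph.abs_noiseMatrix_le (hA : IsBernoulliGraph P Θ A)
    (hΘ0 : ∀ i j, 0 ≤ Θ i j) (hΘ1 : ∀ i j, Θ i j ≤ 1) (ω : Ω) (i j : Fin n) :
    |noiseMatrix Θ (A ω) i j| ≤ 1 := by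
  by_cases h : i = j
  · simp [noiseMatrix, h]
  · have h0 := hΘ0 i j
    have h1 := hΘ1 i j
    rcases hA.zero_or_one ω i j with h' | h' <;> simp only [noiseMatrix, Matrix.of_apply, h, h',
      if_false] <;> rw [abs_le] <;> constructor <;> linarith

theorem IsBernoulliGraph.integral_entry (hA : IsBernoulliGraph P Θ A) {i j : Fin n} (hij : i < j)
    (hΘ : 0 ≤ Θ i j) : ∫ ω, A ω i j ∂P = Θ i j := by
  have hm : MeasurableSet {ω | A ω i j = 1} :=
    hA.measurable_entry i j (measurableSet_singleton 1)
  have h : (fun ω => A ω i j) = Set.indicator {ω | A ω i j = 1} 1 := by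
    ext ω
    rcases hA.zero_or_one ω i j with h | h <;> simp [Set.indicator, h]
  rw [h, integral_indicator_one hm,
    measureReal_def, hA.prob_edge i j hij, ENNReal.toReal_ofReal hΘ]

variable [IsProbabilityMeasure P]

theorem IsBernoulliGraph.integrable_entry (hA : IsBernoulliGraph P Θ A) (i j : Fin n) :
    Integrable (fun ω => A ω i j) P := by
  refine Integrable.of_bound (hA.measurable_entry i j).aestronglyMeasurable 1
    (.of_forall fun ω => ?_)
  rcases hA.zero_or_one ω i j with h | h <;> simp [h]

theorem IsBernoulliGraph.integral_sub_pow (hA : IsBernoulliGraph P Θ A) {i j : Fin n} (hij : i < j)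
    (hΘ : 0 ≤ Θ i j) (k : ℕ) :
    ∫ ω, (A ω i j - Θ i j) ^ k ∂P =
      Θ i j * (1 - Θ i j) ^ k + (1 - Θ i j) * (-Θ i j) ^ k := by
  have h : ∀ ω, (A ω i j - Θ i j) ^ k =
      (-Θ i j) ^ k + ((1 - Θ i j) ^ k - (-Θ i j) ^ k) * A ω i j := fun ω => by
    rcases hA.zero_or_one ω i j with h | h <;> simp [h]
  simp_rw [h]
  rw [integral_add (integrable_const _) ((hA.integrable_entry i j).const_mul _),
    integral_const_mul, hA.integral_entry hij hΘ]
  simp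
  ring

theorem abs_bernoulli_moment_le {θ : ℝ} (h0 : 0 ≤ θ) (h1 : θ ≤ 1) {k : ℕ} (hk : 2 ≤ k) :
    |θ * (1 - θ) ^ k + (1 - θ) * (-θ) ^ k| ≤ θ := by
  have h2 : (1 - θ) ^ k ≤ 1 - θ := pow_le_of_le_one (by linarith) (by linarith) (by omega)
  have h3 : θ ^ k ≤ θ ^ 2 := pow_le_pow_of_le_one h0 h1 hk
  calc _ ≤ |θ * (1 - θ) ^ k| + |(1 - θ) * (-θ) ^ k| := abs_add_le _ _
    _ = θ * (1 - θ) ^ k + (1 - θ) * θ ^ k := by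
        rw [abs_mul, abs_mul, abs_pow, abs_pow, abs_neg, abs_of_nonneg h0,
          abs_of_nonneg (sub_nonneg.2 h1)]
    _ ≤ θ * (1 - θ) + (1 - θ) * θ ^ 2 := by
        have : 0 ≤ 1 - θ := by linarith
        gcongr
    _ ≤ θ := by nlinarith [pow_nonneg h0 3]

/-- The entry of the noise matrix on an undirected edge. -/
def edgeNoise (Θ M : Matrix (Fin n) (Fin n) ℝ) (hΘ : ∀ i j, Θ i j = Θ j i)
    (hM : ∀ i j, M i j = M j i) : Sym2 (Fin n) → ℝ :=
  Sym2.lift ⟨fun i j => noiseMatrix Θ M i j, fun i j => (noiseMatrix_isSymm hΘ hM).apply j i⟩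

/-- Powers of the entries of the noise matrix on distinct edges are uncorrelated. -/
theorem IsBernoulliGraph.integral_prod_edgeNoise (hA : IsBernoulliGraph P Θ A)
    (hΘ : ∀ i j, Θ i j = Θ j i) (k : Sym2 (Fin n) → ℕ) :
    ∫ ω, ∏ e, edgeNoise Θ (A ω) hΘ (hA.symmetric ω) e ^ k e ∂P =
      ∏ e, ∫ ω, edgeNoise Θ (A ω) hΘ (hA.symmetric ω) e ^ k e ∂P := by
  have hdiag : ∀ e : Sym2 (Fin n), e.IsDiag →
      ∀ ω, edgeNoise Θ (A ω) hΘ (hA.symmetric ω) e = 0 := fun e he ω => by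
    induction e using Sym2.ind with
    | _ i j => simp [edgeNoise, noiseMatrix, Sym2.mk_isDiag_iff.1 he]
  by_cases hk : ∃ e : Sym2 (Fin n), e.IsDiag ∧ k e ≠ 0
  · obtain ⟨e, he, hke⟩ := hk
    rw [Finset.prod_eq_zero (Finset.mem_univ e) (by simp [hdiag e he, hke])]
    have : ∀ ω, ∏ e, edgeNoise Θ (A ω) hΘ (hA.symmetric ω) e ^ k e = 0 := fun ω =>
      Finset.prod_eq_zero (Finset.mem_univ e) (by simp [hdiag e he, hke])
    simp [this]
  · push Not at hk
    let φ : {e : Fin n × Fin n // e.1 < e.2} → Sym2 (Fin n) := fun e => s(e.1.1, e.1.2)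
    have hφ : Function.Injective φ := by
      rintro ⟨⟨a, b⟩, h⟩ ⟨⟨a', b'⟩, h'⟩ hab
      simp only [φ, Sym2.eq_iff] at hab
      rcases hab with ⟨rfl, rfl⟩ | ⟨rfl, rfl⟩
      · rfl
      · exact absurd h (lt_asymm h')
    have hrange : ∀ e, e ∉ Set.range φ → e.IsDiag := fun e he => by
      induction e using Sym2.ind with
      | _ i j =>
        rw [Sym2.mk_isDiag_iff]
        rcases lt_trichotomy i j with h | h | h
        · exact absurd ⟨⟨(i, j), h⟩, rfl⟩ he
        · exact h
        · exact absurd ⟨⟨(j, i), h⟩, Sym2.eq_swap⟩ he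
    have hval : ∀ (e : {e : Fin n × Fin n // e.1 < e.2}) (ω : Ω),
        A ω e.1.1 e.1.2 - Θ e.1.1 e.1.2 = edgeNoise Θ (A ω) hΘ (hA.symmetric ω) (φ e) :=
      fun e ω => by simp [edgeNoise, φ, noiseMatrix, e.2.ne]
    rw [← Fintype.prod_of_injective φ hφ
      (fun e => ∫ ω, (A ω e.1.1 e.1.2 - Θ e.1.1 e.1.2) ^ k (φ e) ∂P) _
      (fun e he => by simp [hk e (hrange e he)]) (fun e => by simp_rw [hval])]
    have : ∀ ω, ∏ e, edgeNoise Θ (A ω) hΘ (hA.symmetric ω) e ^ k e =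
        ∏ e : {e : Fin n × Fin n // e.1 < e.2},
          (A ω e.1.1 e.1.2 - Θ e.1.1 e.1.2) ^ k (φ e) := fun ω =>
      (Fintype.prod_of_injective φ hφ _ _
        (fun e he => by simp [hk e (hrange e he)]) (fun e => by rw [hval])).symm
    simp_rw [this]
    exact hA.independent.integral_fun_prod_comp
      (f := fun e x => (x - Θ e.1.1 e.1.2) ^ k (φ e))
      (fun e => (hA.measurable_entry _ _).aemeasurable)
      fun e => by fun_prop

theorem IsBernoulliGraph.integrable_prod_noiseMatrix (hA : IsBernoulliGraph P Θ A)
    (hΘ0 : ∀ i j, 0 ≤ Θ i j) (hΘ1 : ∀ i j, Θ i j ≤ 1) {N : ℕ} (w : Fin (N + 1) → Fin n) :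
    Integrable (fun ω => ∏ l : Fin N, noiseMatrix Θ (A ω) (w l.castSucc) (w l.succ)) P := by
  refine Integrable.of_bound (Measurable.aestronglyMeasurable ?_) 1 (.of_forall fun ω => ?_)
  · exact Finset.measurable_fun_prod _ fun l _ => hA.measurable_noiseMatrix _ _
  · rw [Real.norm_eq_abs, Finset.abs_prod]
    exact Finset.prod_le_one (fun _ _ => abs_nonneg _)
      fun l _ => hA.abs_noiseMatrix_le hΘ0 hΘ1 ω _ _

open Classical in
/-- The expected contribution of a walk to the trace moments of the noise matrix. -/
theorem IsBernoulliGraph.integral_prod_noiseMatrix_le (hA : IsBernoulliGraph P Θ A)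
    (hΘ : ∀ i j, Θ i j = Θ j i) (hΘ0 : ∀ i j, 0 ≤ Θ i j) (hΘp : ∀ i j, Θ i j ≤ p) (hp0 : 0 ≤ p)
    (hp1 : p ≤ 1) {N : ℕ} (w : Fin (N + 1) → Fin n) :
    ∫ ω, ∏ l : Fin N, noiseMatrix Θ (A ω) (w l.castSucc) (w l.succ) ∂P ≤
      if RepeatsEdges w then p ^ ((Finset.univ.image w).card - 1) else 0 := by
  let μ : Sym2 (Fin n) → ℕ → ℝ := fun e k =>
    ∫ ω, edgeNoise Θ (A ω) hΘ (hA.symmetric ω) e ^ k ∂P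
  have key : ∫ ω, ∏ l : Fin N, noiseMatrix Θ (A ω) (w l.castSucc) (w l.succ) ∂P =
      ∏ e, μ e (edgeCount w e) := by
    rw [← hA.integral_prod_edgeNoise hΘ]
    exact integral_congr_ae (.of_forall fun ω =>
      prod_walkEdge w (edgeNoise Θ (A ω) hΘ (hA.symmetric ω)))
  have hμ : ∀ i j k, i < j →
      μ s(i, j) k = Θ i j * (1 - Θ i j) ^ k + (1 - Θ i j) * (-Θ i j) ^ k := fun i j k hij => by
    rw [← hA.integral_sub_pow hij (hΘ0 i j)]
    simp [μ, edgeNoise, noiseMatrix, hij.ne]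
  have hμd : ∀ i k, k ≠ 0 → μ s(i, i) k = 0 := fun i k hk => by
    simp [μ, edgeNoise, noiseMatrix, hk]
  have h1 : ∀ e, μ e 1 = 0 := fun e => by
    induction e using Sym2.ind with
    | _ i j =>
      rcases lt_trichotomy i j with h | rfl | h
      · rw [hμ i j 1 h]; ring
      · exact hμd i 1 one_ne_zero
      · rw [Sym2.eq_swap, hμ j i 1 h]; ring
  have h2 : ∀ e, ∀ k, 2 ≤ k → |μ e k| ≤ p := fun e k hk => by
    induction e using Sym2.ind with
    | _ i j =>
      rcases lt_trichotomy i j with h | rfl | h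
      · rw [hμ i j k h]
        exact (abs_bernoulli_moment_le (hΘ0 i j) ((hΘp i j).trans hp1) hk).trans (hΘp i j)
      · rw [hμd i k (by omega), abs_zero]; exact hp0
      · rw [Sym2.eq_swap, hμ j i k h]
        exact (abs_bernoulli_moment_le (hΘ0 j i) ((hΘp j i).trans hp1) hk).trans (hΘp j i)
  rw [key]
  split_ifs with hw
  · exact prod_moments_le hw hp0 hp1 (fun e => by simp [μ]) h2
  · exact (prod_moments_eq_zero hw h1).le

variable {V : Type*} [Fintype V] [DecidableEq V]

/-- The trace moments of a principal submatrix of the noise matrix are controlled by the operator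
norm of the comparison matrix of dimension `r ≥ |V| p + q`. -/
theorem IsBernoulliGraph.integral_trace_noiseMatrix_pow_le (hA : IsBernoulliGraph P Θ A)
    (hΘ : ∀ i j, Θ i j = Θ j i) (hΘ0 : ∀ i j, 0 ≤ Θ i j) (hΘp : ∀ i j, Θ i j ≤ p) (hp0 : 0 ≤ p)
    (hp1 : p ≤ 1) {ι : V → Fin n} (hι : Function.Injective ι) {q r : ℕ} (hr0 : 0 < r)
    (hr : Fintype.card V * p + q ≤ r) :
    Integrable (fun ω => (((noiseMatrix Θ (A ω)).submatrix ι ι) ^ (2 * q)).trace) P ∧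
    ∫ ω, (((noiseMatrix Θ (A ω)).submatrix ι ι) ^ (2 * q)).trace ∂P ≤
      Fintype.card V * (2 * (532 * √r) ^ (2 * q)) := by
  classical
  have hint : ∀ w : Fin (2 * q + 1) → V, Integrable (fun ω => if w 0 = w (Fin.last (2 * q)) then
      ∏ l : Fin (2 * q), (noiseMatrix Θ (A ω)).submatrix ι ι (w l.castSucc) (w l.succ) else 0) P :=
    fun w => by
      split_ifs
      · exact hA.integrable_prod_noiseMatrix hΘ0 (fun i j => (hΘp i j).trans hp1) (ι ∘ w)
      · exact integrable_zero _ _ _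
  simp_rw [Matrix.trace_pow_eq_sum_walk]
  refine ⟨integrable_finsetSum _ fun w _ => hint w, ?_⟩
  rw [integral_finsetSum _ fun w _ => hint w]
  have hw : ∀ w : Fin (2 * q + 1) → V, (∫ ω, (if w 0 = w (Fin.last (2 * q)) then
      ∏ l : Fin (2 * q), (noiseMatrix Θ (A ω)).submatrix ι ι (w l.castSucc) (w l.succ) else 0) ∂P)
      ≤ if IsRepeatingClosedWalk w then p ^ ((Finset.univ.image w).card - 1) else 0 := fun w => by
    by_cases hc : w 0 = w (Fin.last (2 * q))
    swap
    · simp [hc, IsRepeatingClosedWalk]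
    have hker : Setoid.ker (ι ∘ w) = Setoid.ker w := by
      ext a b; simp [Setoid.ker_def, hι.eq_iff]
    have hcard : (Finset.univ.image (ι ∘ w)).card = (Finset.univ.image w).card := by
      rw [← Finset.image_image, Finset.card_image_of_injective _ hι]
    simp only [hc, if_true]
    refine (hA.integral_prod_noiseMatrix_le hΘ hΘ0 hΘp hp0 hp1 (ι ∘ w)).trans ?_
    rw [hcard]
    by_cases hrep : RepeatsEdges (ι ∘ w)
    · rw [if_pos hrep, if_pos (isRepeatingClosedWalk_of_ker_eq hker ⟨congrArg ι hc, hrep⟩)]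
    · rw [if_neg hrep]
      split_ifs <;> positivity
  have : Nonempty (Fin r) := ⟨⟨0, hr0⟩⟩
  have hr' : (0 : ℝ) < r := by exact_mod_cast hr0
  have hqr : q ≤ r := by
    have : 0 ≤ Fintype.card V * p := by positivity
    have : (q : ℝ) ≤ r := by linarith
    exact_mod_cast this
  have h1 := sum_repeatingClosedWalk_le (V := V) (R := Fin r) q hp0 (by simpa using hr)
  have h2 := card_repeatingClosedWalk_le_sum_trace (R := Fin r) (2 * q)
  have h3 : ∑ f : Sym2 (Fin r) → Fin 3, (skewMatrix f ^ (2 * q)).trace ≤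
      r * (3 ^ Fintype.card (Sym2 (Fin r)) * (2 * (532 * √r) ^ (2 * q))) := by
    calc _ ≤ ∑ f : Sym2 (Fin r) → Fin 3, r * ‖skewMatrix f‖ ^ (2 * q) := by
          refine Finset.sum_le_sum fun f _ => ?_
          simpa using trace_pow_le_card_mul (skewMatrix_isSymm f) q
      _ ≤ _ := by
          rw [← Finset.mul_sum]
          gcongr
          simpa using sum_l2_opNorm_skewMatrix_pow_le (R := Fin r) (by simpa using hqr)
  rw [Fintype.card_fin] at h1
  refine (Finset.sum_le_sum fun w _ => hw w).trans ?_
  set s := ∑ w : Fin (2 * q + 1) → Fin r, if IsRepeatingClosedWalk w then (1 : ℝ) else 0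
  have h4 : s ≤ r * (2 * (532 * √r) ^ (2 * q)) := by
    have h5 : (0 : ℝ) < 3 ^ Fintype.card (Sym2 (Fin r)) := by positivity
    refine le_of_mul_le_mul_left ((h2.trans h3).trans (le_of_eq ?_)) h5
    ring
  refine le_of_mul_le_mul_left (h1.trans ?_) hr'
  calc _ ≤ Fintype.card V * (r * (2 * (532 * √r) ^ (2 * q))) := by gcongr
    _ = _ := by ring

/-- Markov's inequality for a trace moment whose order is a power of two. -/
theorem IsBernoulliGraph.measureReal_l2_opNorm_noiseMatrix_ge_le (hA : IsBernoulliGraph P Θ A)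
    (hΘ : ∀ i j, Θ i j = Θ j i) (hΘ0 : ∀ i j, 0 ≤ Θ i j) (hΘp : ∀ i j, Θ i j ≤ p) (hp0 : 0 ≤ p)
    (hp1 : p ≤ 1) {ι : V → Fin n} (hι : Function.Injective ι) {k r : ℕ}
    (hr : Fintype.card V * p + (2 ^ k : ℕ) ≤ r) :
    P.real {ω | Real.exp 3 * (532 * √r) ≤ ‖(noiseMatrix Θ (A ω)).submatrix ι ι‖} ≤
      2 * Fintype.card V * Real.exp (-6 * (2 ^ k : ℕ)) := by
  have hr' : (0 : ℝ) < r := by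
    have : 0 ≤ Fintype.card V * p := by positivity
    have : (0 : ℝ) < (2 ^ k : ℕ) := by positivity
    linarith
  obtain ⟨hint, hle⟩ := hA.integral_trace_noiseMatrix_pow_le hΘ hΘ0 hΘp hp0 hp1 hι (q := 2 ^ k)
    (by exact_mod_cast hr') hr
  have hnorm : ∀ ω, ‖(noiseMatrix Θ (A ω)).submatrix ι ι‖ ^ (2 * 2 ^ k) ≤
      (((noiseMatrix Θ (A ω)).submatrix ι ι) ^ (2 * 2 ^ k)).trace := fun ω =>
    l2_opNorm_pow_le_trace ((noiseMatrix_isSymm hΘ (hA.symmetric ω)).submatrix ι) k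
  set b : ℝ := 532 * √r with hb
  have hb0 : 0 < b := by positivity
  have hmarkov := mul_meas_ge_le_integral_of_nonneg
    (.of_forall fun ω => (pow_nonneg (norm_nonneg _) _).trans (hnorm ω)) hint
    ((Real.exp 3 * b) ^ (2 * 2 ^ k))
  have hsub : {ω | Real.exp 3 * b ≤ ‖(noiseMatrix Θ (A ω)).submatrix ι ι‖} ⊆
      {ω | (Real.exp 3 * b) ^ (2 * 2 ^ k) ≤
        (((noiseMatrix Θ (A ω)).submatrix ι ι) ^ (2 * 2 ^ k)).trace} := fun ω hω =>
    (pow_le_pow_left₀ (by positivity) hω _).trans (hnorm ω)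
  have h1 := measureReal_mono (μ := P) hsub
  have h2 : (Real.exp 3 * b) ^ (2 * 2 ^ k) *
      P.real {ω | Real.exp 3 * b ≤ ‖(noiseMatrix Θ (A ω)).submatrix ι ι‖} ≤
        Fintype.card V * (2 * b ^ (2 * 2 ^ k)) :=
    (mul_le_mul_of_nonneg_left h1 (by positivity)).trans (hmarkov.trans hle)
  have h3 : Real.exp 3 ^ (2 * 2 ^ k) = (Real.exp (-6 * (2 ^ k : ℕ)))⁻¹ := by
    rw [← Real.exp_neg, ← Real.exp_nat_mul]
    push_cast
    ring_nf
  rw [mul_pow, h3] at h2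
  have h4 : 0 < Real.exp (-6 * (2 ^ k : ℕ)) := Real.exp_pos _
  refine le_of_mul_le_mul_left ?_ (show 0 < (Real.exp (-6 * (2 ^ k : ℕ)))⁻¹ * b ^ (2 * 2 ^ k) by
    positivity)
  refine h2.trans (le_of_eq ?_)
  field_simp

end Noise

/-! ### The block criterion and refinements of the true communities -/

section Criterion

open scoped Matrix.Norms.L2Operator

variable {n : ℕ} {c : Fin n → ℕ} {M M' : Matrix (Fin n) (Fin n) ℝ} {t : ℕ}

theorem blockCriterion_nonneg (t : ℕ) (c : Fin n → ℕ) (M : Matrix (Fin n) (Fin n) ℝ) :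
    0 ≤ blockCriterion t c M :=
  Real.iSup_nonneg fun _ => sigmaTwo_nonneg _

theorem sigmaTwo_le_blockCriterion {k : ℕ} (hk : k ∈ Set.Icc 1 t) :
    sigmaTwo (diagBlock c M k) ≤ blockCriterion t c M :=
  le_ciSup (f := fun k : Set.Icc 1 t => sigmaTwo (diagBlock c M k)) (Set.finite_range _).bddAbove
    ⟨k, hk⟩

theorem blockCriterion_le {b : ℝ} (hb : 0 ≤ b)
    (h : ∀ k ∈ Set.Icc 1 t, sigmaTwo (diagBlock c M k) ≤ b) : blockCriterion t c M ≤ b :=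
  Real.iSup_le (fun k => h k k.2) hb

theorem blockCriterion_le_add {δ : ℝ} (hδ : 0 ≤ δ)
    (h : ∀ k ∈ Set.Icc 1 t, ‖diagBlock c M k - diagBlock c M' k‖ ≤ δ) :
    blockCriterion t c M ≤ blockCriterion t c M' + δ := by
  refine blockCriterion_le (add_nonneg (blockCriterion_nonneg _ _ _) hδ) fun k hk => ?_
  exact (sigmaTwo_le_add _ (diagBlock c M' k)).trans
    (add_le_add (sigmaTwo_le_blockCriterion hk) (h k hk))

theorem blockCriterion_le_card_mul {p b : ℝ} (hp : 0 ≤ p) (hM : ∀ i j, |M i j| ≤ p) (hb : 0 ≤ b)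
    (hc : ∀ k ∈ Set.Icc 1 t, (communitySize c k : ℝ) ≤ b) : blockCriterion t c M ≤ b * p := by
  refine blockCriterion_le (by positivity) fun k hk => (sigmaTwo_le_norm _).trans ?_
  exact (l2_opNorm_le_card_mul (diagBlock c M k) (fun i j => hM i.1 j.1) hp).trans
    (mul_le_mul_of_nonneg_right (hc k hk) hp)

/-- On a set of vertices with a common true label the edge probabilities have rank one. -/
theorem blockCriterion_pabmTheta_eq_zero {lam : Fin n → ℕ → ℝ} {cstar : Fin n → ℕ}
    (h : ∀ i j, c i = c j → cstar i = cstar j) :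
    blockCriterion t c (pabmTheta lam cstar) = 0 := by
  refine le_antisymm (blockCriterion_le le_rfl fun k _ => le_of_eq ?_) (blockCriterion_nonneg _ _ _)
  have : diagBlock c (pabmTheta lam cstar) k = Matrix.vecMulVec
      (fun i : {i // c i = k} => lam i (cstar i)) (fun i : {i // c i = k} => lam i (cstar i)) := by
    ext i j
    simp [diagBlock, pabmTheta, Matrix.vecMulVec_apply, h i j (i.2.trans j.2.symm)]
  rw [this, sigmaTwo_vecMulVec]

end Criterion

section Refinement

variable {n K t : ℕ} {cstar : Fin n → ℕ}

/-- The number of parts of community `k` when the labels `1, …, t` are dealt to the communities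
`1, …, K` in turn. -/
def partCount (K t k : ℕ) : ℕ := (t - k) / K + 1

/-- A labeling that refines `cstar`: the members of community `k`, enumerated arbitrarily, are dealt
in turn to the labels of `{1, …, t}` that are congruent to `k` modulo `K`. -/
noncomputable def refineLabel (K t : ℕ) (cstar : Fin n → ℕ) (i : Fin n) : ℕ :=
  K * ((Fintype.equivFin {j // cstar j = cstar i} ⟨i, rfl⟩ : ℕ) % partCount K t (cstar i)) +
    cstar i

theorem mul_add_inj_of_mem_Icc {a b k l : ℕ} (hk : k ∈ Set.Icc 1 K) (hl : l ∈ Set.Icc 1 K)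
    (h : K * a + k = K * b + l) : a = b ∧ k = l := by
  obtain ⟨k, rfl⟩ := Nat.exists_eq_add_of_le' hk.1
  obtain ⟨l, rfl⟩ := Nat.exists_eq_add_of_le' hl.1
  have hk' : k < K := hk.2
  have hl' : l < K := hl.2
  have h' : K * a + k = K * b + l := by omega
  have h1 := congrArg (· / K) h'
  have hK : 0 < K := by omega
  simp only [Nat.mul_add_div hK, Nat.div_eq_of_lt hk', Nat.div_eq_of_lt hl'] at h1
  obtain rfl : a = b := by omega
  exact ⟨rfl, by omega⟩

theorem refineLabel_refines (h : IsLabeling K cstar) (i j : Fin n)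
    (hij : refineLabel K t cstar i = refineLabel K t cstar j) : cstar i = cstar j :=
  (mul_add_inj_of_mem_Icc (h i) (h j) hij).2

theorem isLabeling_refineLabel (h : IsLabeling K cstar) (hKt : K ≤ t) :
    IsLabeling t (refineLabel K t cstar) := by
  intro i
  have h1 := (h i).1
  have h2 := (h i).2
  refine ⟨h1.trans (Nat.le_add_left _ _), ?_⟩
  set s := (Fintype.equivFin {j // cstar j = cstar i} ⟨i, rfl⟩ : ℕ) % partCount K t (cstar i)
    with hs
  have h3 : s ≤ (t - cstar i) / K := Nat.lt_succ_iff.1 (Nat.mod_lt _ (Nat.succ_pos _))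
  have h4 : K * s ≤ t - cstar i := (Nat.mul_le_mul_left K h3).trans (Nat.mul_div_le _ _)
  have : refineLabel K t cstar i = K * s + cstar i := rfl
  omega

theorem communitySize_refineLabel (h : IsLabeling K cstar) {k s : ℕ} (hk : k ∈ Set.Icc 1 K)
    (hs : s < partCount K t k) :
    communitySize (refineLabel K t cstar) (K * s + k) =
      (communitySize cstar k).count (· ≡ s [MOD partCount K t k]) := by
  let e := Fintype.equivFin {j // cstar j = k}
  have hlab : ∀ (i : Fin n) (hi : cstar i = k),
      refineLabel K t cstar i = K * ((e ⟨i, hi⟩ : ℕ) % partCount K t k) + k := fun i hi => by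
    subst hi; rfl
  rw [Nat.count_eq_card_filter_range, ← Fintype.card_coe]
  refine Fintype.card_congr
    { toFun := fun i => ⟨e ⟨i.1, ?_⟩, ?_⟩
      invFun := fun x => ⟨(e.symm ⟨x.1, ?_⟩).1, ?_⟩
      left_inv := fun i => ?_
      right_inv := fun x => ?_ }
  · exact (mul_add_inj_of_mem_Icc (h i) hk i.2).2
  · have hi := (mul_add_inj_of_mem_Icc (h i) hk i.2).2
    have h1 := i.2
    rw [hlab i hi] at h1
    rw [Finset.mem_filter, Finset.mem_range]
    refine ⟨Fin.is_lt _, ?_⟩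
    rw [Nat.ModEq, Nat.mod_eq_of_lt hs]
    exact (mul_add_inj_of_mem_Icc hk hk h1).1
  · exact Finset.mem_range.1 (Finset.mem_filter.1 x.2).1
  · have hx := (Finset.mem_filter.1 x.2).2
    rw [Nat.ModEq, Nat.mod_eq_of_lt hs] at hx
    rw [hlab _ (e.symm _).2]
    simp [hx]
  · simp
  · simp

/-- Each community is divided into at least `t / (2 K)` and at most `2 t / K` parts, so that the
sizes of the parts deviate from `n / t` by a factor of at most `2 C₀`, up to rounding. The two last
hypotheses let `B > 2 C₀` absorb the rounding. -/
theorem isBalanced_refineLabel {C₀ B : ℝ} (hC₀ : 1 ≤ C₀) (h : IsLabeling K cstar)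
    (hbal : IsBalanced C₀ K cstar) (hK : 1 ≤ K) (hKt : K ≤ t)
    (hlow : 1 ≤ (n : ℝ) / t * (1 / (2 * C₀) - 1 / B)) (hup : 1 ≤ (n : ℝ) / t * (B - 2 * C₀)) :
    IsBalanced B t (refineLabel K t cstar) := by
  intro l hl
  have hK0 : (0 : ℝ) < K := by exact_mod_cast hK
  have ht0 : (0 : ℝ) < t := by exact_mod_cast hK.trans hKt
  obtain ⟨k, s, hk, hs, rfl⟩ : ∃ k s, k ∈ Set.Icc 1 K ∧ s < partCount K t k ∧ l = K * s + k := by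
    have h1 := Nat.mod_lt (l - 1) hK
    have h2 := Nat.div_add_mod (l - 1) K
    have h3 := hl.1
    have h4 := hl.2
    refine ⟨(l - 1) % K + 1, (l - 1) / K, ⟨by omega, by omega⟩, ?_, by omega⟩
    rw [partCount, Nat.lt_succ_iff, Nat.le_div_iff_mul_le hK, mul_comm]
    omega
  rw [communitySize_refineLabel h hk hs, Nat.count_modEq_card _
    (show 0 < partCount K t k from Nat.succ_pos _)]
  set m := partCount K t k with hm
  set N := communitySize cstar k
  have hm0 : (0 : ℝ) < m := by rw [hm]; exact_mod_cast Nat.succ_pos _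
  have hm1 : (m : ℝ) ≤ 2 * t / K := by
    rw [le_div_iff₀ hK0]
    have h1 := Nat.div_mul_le_self (t - k) K
    have h2 : m * K ≤ 2 * t := by
      rw [hm, partCount, add_mul, one_mul]; omega
    exact_mod_cast h2
  have hm2 : (t : ℝ) / (2 * K) ≤ m := by
    rw [div_le_iff₀ (by positivity)]
    have h1 := Nat.lt_div_mul_add (a := t - k) hK
    have h2 : t ≤ m * (2 * K) := by
      have h3 := hk.2
      have h4 : m * K = (t - k) / K * K + K := by rw [hm, partCount, add_mul, one_mul]
      have h5 : m * (2 * K) = 2 * (m * K) := by ring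
      rw [h5, h4]
      omega
    exact_mod_cast h2
  -- The part counts the residues `s` among `N` numbers, hence has size `N / m` up to rounding.
  have hN := hbal k hk
  have hfl : (N : ℝ) / m - 1 ≤ ((N / m : ℕ) : ℝ) := by
    have := Nat.lt_floor_add_one ((N : ℝ) / m)
    rw [Nat.floor_div_eq_div] at this
    linarith
  have hfu : ((N / m : ℕ) : ℝ) ≤ (N : ℝ) / m := Nat.cast_div_le
  have hq1 : (n : ℝ) / t * (1 / (2 * C₀)) ≤ N / m := by
    calc (n : ℝ) / t * (1 / (2 * C₀)) = (n / (C₀ * K)) / (2 * t / K) := by field_simp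
      _ ≤ N / m := by
          gcongr
          exact hN.1
  have hq2 : (N : ℝ) / m ≤ n / t * (2 * C₀) := by
    calc (N : ℝ) / m ≤ (C₀ * n / K) / (t / (2 * K)) := by
          gcongr
          exact hN.2
      _ = _ := by field_simp
  have hi : (0 : ℝ) ≤ (if s % m < N % m then (1 : ℕ) else 0 : ℕ) ∧
      ((if s % m < N % m then (1 : ℕ) else 0 : ℕ) : ℝ) ≤ 1 := by
    split_ifs <;> norm_num
  have e1 : (n : ℝ) / (B * t) = n / t * (1 / B) := by
    rw [div_mul_div_comm, mul_one, mul_comm B]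
  have e2 : B * (n : ℝ) / t = n / t * B := by ring
  rw [e1, e2]
  push_cast at hi ⊢
  constructor <;> nlinarith

/-- With at least `K` communities allowed, the population criterion vanishes at its minimizers. -/
theorem blockCriterion_eq_zero_of_mem_balancedArgmin {C₀ B : ℝ} {lam : Fin n → ℕ → ℝ}
    {c : Fin n → ℕ} (hC₀ : 1 ≤ C₀) (h : IsLabeling K cstar) (hbal : IsBalanced C₀ K cstar)
    (hK : 1 ≤ K) (hKt : K ≤ t) (hlow : 1 ≤ (n : ℝ) / t * (1 / (2 * C₀) - 1 / B))
    (hup : 1 ≤ (n : ℝ) / t * (B - 2 * C₀))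
    (hc : c ∈ balancedArgmin B t (pabmTheta lam cstar)) :
    blockCriterion t c (pabmTheta lam cstar) = 0 := by
  refine le_antisymm ?_ (blockCriterion_nonneg _ _ _)
  refine (hc.2.2 _ (isLabeling_refineLabel h hKt)
    (isBalanced_refineLabel hC₀ h hbal hK hKt hlow hup)).trans (le_of_eq ?_)
  exact blockCriterion_pabmTheta_eq_zero (refineLabel_refines h)

end Refinement

/-! ### Uniform concentration over the blocks -/

section Uniform

open scoped Matrix.Norms.L2Operator

/-- The constant in the spectral norm bound for the blocks of the noise matrix, when a block of
a labeling with `t` labels has at most `B n / t` vertices. -/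
noncomputable def noiseConst (B : ℝ) : ℝ := Real.exp 3 * (532 * √(B + 3))

theorem noiseConst_nonneg (B : ℝ) : 0 ≤ noiseConst B := by
  unfold noiseConst
  positivity

variable {n : ℕ}

/-- With high probability every block of every given labeling has noise of the order of
`√(n p / t)`, the square root of the expected degree in a block. -/
theorem IsBernoulliGraph.measureReal_exists_block_noise_le {Ω : Type*} [MeasurableSpace Ω]
    {P : Measure Ω} [IsProbabilityMeasure P] {Θ : Matrix (Fin n) (Fin n) ℝ}
    {A : Ω → Matrix (Fin n) (Fin n) ℝ} (hA : IsBernoulliGraph P Θ A) {p B : ℝ}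
    (hΘ : ∀ i j, Θ i j = Θ j i) (hΘ0 : ∀ i j, 0 ≤ Θ i j) (hΘp : ∀ i j, Θ i j ≤ p) (hp0 : 0 ≤ p)
    (hp1 : p ≤ 1) {Kmax : ℕ} {c : ℕ → Fin n → ℕ}
    (hc : ∀ t ∈ Set.Icc 1 Kmax, ∀ k ∈ Set.Icc 1 t, (communitySize (c t) k : ℝ) ≤ B * n / t)
    (hL : 1 ≤ Real.log n) (hK : Kmax ≤ n)
    (hx : ∀ t ∈ Set.Icc 1 Kmax, Real.log n ^ 2 ≤ n * p / t) :
    P.real {ω | ∃ t ∈ Set.Icc 1 Kmax, ∃ k ∈ Set.Icc 1 t,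
      noiseConst B * √(n * p / t) < ‖diagBlock (c t) (noiseMatrix Θ (A ω)) k‖} ≤ (n : ℝ)⁻¹ := by
  have hn0 : (0 : ℝ) < n := by
    rcases Nat.eq_zero_or_pos n with rfl | h
    · norm_num at hL
    · exact_mod_cast h
  have hn2 : (2 : ℝ) ≤ n := by
    have h1 := Real.log_le_sub_one_of_pos hn0
    linarith
  -- The order of the trace moment is a power of two between `log n` and `2 log n`.
  obtain ⟨k₀, hk1, hk2⟩ := exists_nat_pow_near hL (one_lt_two : (1 : ℝ) < 2)
  have hq1 : Real.log n ≤ ((2 ^ (k₀ + 1) : ℕ) : ℝ) := by push_cast; exact hk2.le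
  have hq2 : ((2 ^ (k₀ + 1) : ℕ) : ℝ) ≤ 2 * Real.log n := by push_cast; rw [pow_succ]; linarith
  -- Blocks are indexed by pairs `(t, k)`; there are at most `n ^ 2` of them.
  set S : Finset (ℕ × ℕ) := (Finset.Icc 1 Kmax ×ˢ Finset.Icc 1 Kmax).filter fun z => z.2 ≤ z.1
    with hS
  let bad : ℕ × ℕ → Set Ω := fun z =>
    {ω | noiseConst B * √(n * p / z.1) < ‖diagBlock (c z.1) (noiseMatrix Θ (A ω)) z.2‖}
  have hsub : {ω | ∃ t ∈ Set.Icc 1 Kmax, ∃ k ∈ Set.Icc 1 t,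
      noiseConst B * √(n * p / t) < ‖diagBlock (c t) (noiseMatrix Θ (A ω)) k‖} ⊆
      ⋃ z ∈ S, bad z := by
    rintro ω ⟨t, ht, k, hk, h⟩
    simp only [Set.mem_iUnion]
    refine ⟨(t, k), ?_, h⟩
    simp only [hS, Finset.mem_filter, Finset.mem_product, Finset.mem_Icc]
    exact ⟨⟨ht, hk.1, hk.2.trans ht.2⟩, hk.2⟩
  have hone : ∀ z ∈ S, P.real (bad z) ≤ 2 * n * ((n : ℝ) ^ 6)⁻¹ := by
    rintro ⟨t, k⟩ hz
    simp only [hS, Finset.mem_filter, Finset.mem_product, Finset.mem_Icc] at hz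
    have ht : t ∈ Set.Icc 1 Kmax := hz.1.1
    have hk : k ∈ Set.Icc 1 t := ⟨hz.1.2.1, hz.2⟩
    have ht0 : (0 : ℝ) < t := by exact_mod_cast ht.1
    set m := communitySize (c t) k with hm
    have hmn : (m : ℝ) ≤ n := by
      have : m ≤ n := by
        have h := Fintype.card_subtype_le fun i => c t i = k
        rwa [Fintype.card_fin] at h
      exact_mod_cast this
    set r := ⌈m * p⌉₊ + 2 ^ (k₀ + 1) with hr
    have hmr : Fintype.card {i // c t i = k} * p + (2 ^ (k₀ + 1) : ℕ) ≤ r := by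
      rw [hr, Nat.cast_add]
      gcongr
      exact Nat.le_ceil _
    have hrx : (r : ℝ) ≤ (B + 3) * (n * p / t) := by
      have h1 : (⌈m * p⌉₊ : ℝ) ≤ m * p + 1 := (Nat.ceil_lt_add_one (by positivity)).le
      have h2 : m * p ≤ B * (n * p / t) := by
        calc m * p ≤ B * n / t * p := by gcongr; exact hc t ht k hk
          _ = _ := by ring
      have h3 := hx t ht
      rw [hr, Nat.cast_add]
      nlinarith
    have hB : Real.exp 3 * (532 * √r) ≤ noiseConst B * √(n * p / t) := by
      have hx0 : 0 ≤ n * p / t := by positivity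
      calc Real.exp 3 * (532 * √r) ≤ Real.exp 3 * (532 * √((B + 3) * (n * p / t))) := by gcongr
        _ = _ := by rw [Real.sqrt_mul' _ hx0, noiseConst]; ring
    refine (measureReal_mono (fun ω hω => ?_)).trans
      ((hA.measureReal_l2_opNorm_noiseMatrix_ge_le hΘ hΘ0 hΘp hp0 hp1
        (ι := (Subtype.val : {i // c t i = k} → Fin n)) Subtype.val_injective hmr).trans ?_)
    · exact hB.trans (le_of_lt hω)
    · have h1 : Real.exp (-6 * (2 ^ (k₀ + 1) : ℕ)) ≤ ((n : ℝ) ^ 6)⁻¹ := by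
        rw [← Real.exp_log (pow_pos hn0 6), ← Real.exp_neg, Real.log_pow]
        refine Real.exp_le_exp.2 ?_
        push_cast at hq1 ⊢
        linarith
      have h2 : (Fintype.card {i // c t i = k} : ℝ) ≤ n := hmn
      gcongr
  have hcard : (S.card : ℝ) ≤ n ^ 2 := by
    have h1 : S.card ≤ Kmax * Kmax := by
      refine (Finset.card_filter_le _ _).trans ?_
      simp
    have h2 : S.card ≤ n ^ 2 := h1.trans (by rw [sq]; exact Nat.mul_le_mul hK hK)
    exact_mod_cast h2
  calc _ ≤ P.real (⋃ z ∈ S, bad z) := measureReal_mono hsub (measure_ne_top _ _)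
    _ ≤ ∑ z ∈ S, P.real (bad z) := measureReal_biUnion_finset_le _ _
    _ ≤ ∑ _z ∈ S, 2 * n * ((n : ℝ) ^ 6)⁻¹ := Finset.sum_le_sum hone
    _ = S.card * (2 * n * ((n : ℝ) ^ 6)⁻¹) := by rw [Finset.sum_const, nsmul_eq_mul]
    _ ≤ n ^ 2 * (2 * n * ((n : ℝ) ^ 6)⁻¹) := by gcongr
    _ = 2 / n ^ 2 * (n : ℝ)⁻¹ := by field_simp
    _ ≤ 1 * (n : ℝ)⁻¹ := by
        gcongr
        rw [div_le_one (by positivity)]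
        nlinarith
    _ = _ := one_mul _

/-- The noise matrix omits the diagonal of `Θ`, whose norm is at most one. -/
theorem l2_opNorm_diagBlock_sub_le {Θ M : Matrix (Fin n) (Fin n) ℝ} (hΘ : ∀ i, |Θ i i| ≤ 1)
    (hM : ∀ i, M i i = 0) (c : Fin n → ℕ) (k : ℕ) :
    ‖diagBlock c M k - diagBlock c Θ k‖ ≤ ‖diagBlock c (noiseMatrix Θ M) k‖ + 1 := by
  have h : diagBlock c M k - diagBlock c Θ k = diagBlock c (noiseMatrix Θ M) k -
      Matrix.diagonal fun i : {i // c i = k} => Θ i i := by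
    ext i j
    by_cases hij : i = j
    · subst hij
      simp [diagBlock, noiseMatrix, hM]
    · simp [diagBlock, noiseMatrix, Subtype.val_inj, hij]
  rw [h]
  refine (norm_sub_le _ _).trans ?_
  gcongr
  rw [Matrix.l2_opNorm_diagonal, pi_norm_le_iff_of_nonneg zero_le_one]
  exact fun i => hΘ i

end Uniform

/-! ### Comparison of the ratios -/

section Ratio

/-- If `F` is a perturbation of a criterion `G` that vanishes from `K` on, and is of the
order of `y / t` up to a factor `√L` before `K`, then the ratio `F (t - 1) / (F t + L)` is larger
at `t = K` than anywhere else: it is of order at least `√(y / K) / √L` there, of order at most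
`√L` before and of order at most `√(y / K) / L` afterwards. -/
theorem ratio_lt_ratio {F G : ℕ → ℝ} {K Kmax : ℕ} {B C₁ D L y H : ℝ} (hK : 2 ≤ K)
    (hF : ∀ t, 0 ≤ F t) (hB : 0 ≤ B) (hC₁ : 0 < C₁) (hD : 0 ≤ D) (hL : 1 ≤ L) (hy : 0 ≤ y)
    (hFG : ∀ t ∈ Set.Icc 1 Kmax, F t ≤ G t + D * √(y / t))
    (hGF : ∀ t ∈ Set.Icc 1 Kmax, G t ≤ F t + D * √(y / t))
    (hG0 : ∀ t ∈ Set.Icc K Kmax, G t = 0)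
    (hG1 : ∀ t, 1 ≤ t → t < K → C₁ * (y / (t * √L)) ≤ G t)
    (hG2 : ∀ t ∈ Set.Icc 1 Kmax, G t ≤ B * (y / t))
    (hH : H * L ≤ √(y / Kmax)) (hH1 : 1 ≤ H) (hH2 : 2 * D / C₁ ≤ H)
    (hH3 : 4 * (B + D) / C₁ < H * (C₁ / (2 * (D + 1))))
    (hLD : D < C₁ / (2 * (D + 1)) * √L) (hKK : K ≤ Kmax)
    {t : ℕ} (ht : t ∈ Set.Icc 2 Kmax) (htK : t ≠ K) :
    F (t - 1) / (F t + L) < F (K - 1) / (F K + L) := by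
  set a := C₁ / (2 * (D + 1)) with ha
  have ha0 : 0 < a := by positivity
  set l := √L with hl
  have hl1 : 1 ≤ l := Real.one_le_sqrt.2 hL
  have hl0 : 0 < l := by linarith
  have hlL : l ^ 2 = L := Real.sq_sqrt (by linarith)
  have hs2 : ∀ t : ℕ, √(y / t) ^ 2 = y / t := fun t => Real.sq_sqrt (by positivity)
  have hsanti : ∀ {u v : ℕ}, 1 ≤ u → u ≤ v → √(y / v) ≤ √(y / u) := fun {u v} hu huv => by
    have : (0 : ℝ) < u := by exact_mod_cast hu
    gcongr
  have hsH : ∀ u ∈ Set.Icc 1 Kmax, H * L ≤ √(y / u) := fun u hu => hH.trans (hsanti hu.1 hu.2)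
  have hsL : ∀ u ∈ Set.Icc 1 Kmax, L ≤ √(y / u) := fun u hu => by
    have := hsH u hu; nlinarith
  have hslow : ∀ u ∈ Set.Icc 1 Kmax, u < K → C₁ * √(y / u) ^ 2 / (2 * l) ≤ F u := fun u hu huK => by
    have h1 := hG1 u hu.1 huK
    have h2 := hGF u hu
    have h3 := hsH u hu
    have h4 : C₁ * (y / (u * l)) = C₁ * √(y / u) ^ 2 / l := by rw [hs2]; field_simp
    rw [h4] at h1
    set s := √(y / u)
    have h5 : D ≤ C₁ * s / (2 * l) := by
      rw [le_div_iff₀ (by positivity)]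
      rw [div_le_iff₀ hC₁] at hH2
      have hlL' : l ≤ L := by nlinarith
      have h6 : H * l ≤ s := (mul_le_mul_of_nonneg_left hlL' (by linarith)).trans h3
      nlinarith
    have hs0 : 0 ≤ s := Real.sqrt_nonneg _
    have h7 : D * s ≤ C₁ * s / (2 * l) * s := by gcongr
    have h8 : C₁ * s ^ 2 / l = C₁ * s ^ 2 / (2 * l) + C₁ * s / (2 * l) * s := by field_simp; ring
    linarith
  have hKm : K ∈ Set.Icc 1 Kmax := ⟨by omega, hKK⟩
  set s := √(y / K) with hs
  have hsK := hsH K hKm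
  have hs0 : 0 < s := by have := hsL K hKm; linarith
  have hRK : a * s / l ≤ F (K - 1) / (F K + L) := by
    have h1 := hslow (K - 1) ⟨by omega, by omega⟩ (by omega)
    have h2 : s ≤ √(y / (K - 1 : ℕ)) := hsanti (by omega) (by omega)
    have h3 : F K + L ≤ (D + 1) * s := by
      have h4 := hFG K hKm
      rw [hG0 K ⟨le_rfl, hKK⟩] at h4
      have := hsL K hKm
      linarith
    calc a * s / l = (C₁ * s ^ 2 / (2 * l)) / ((D + 1) * s) := by rw [ha]; field_simp
      _ ≤ F (K - 1) / (F K + L) := by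
          have : 0 < F K + L := by have := hF K; linarith
          gcongr
          · exact hF _
          · refine le_trans ?_ h1
            gcongr
  refine lt_of_lt_of_le ?_ hRK
  rcases lt_or_gt_of_ne htK with h | h
  · have ht1 : t ∈ Set.Icc 1 Kmax := ⟨by have := ht.1; omega, ht.2⟩
    have ht2 : t - 1 ∈ Set.Icc 1 Kmax := ⟨by have := ht.1; omega, by have := ht.2; omega⟩
    have h1 := hslow t ht1 h
    have h2 := hFG (t - 1) ht2
    have h3 := hG2 (t - 1) ht2
    have h4 := hsL (t - 1) ht2
    have ht0 : (0 : ℝ) < t := by exact_mod_cast ht1.1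
    have h5 : y / (t - 1 : ℕ) ≤ 2 * (y / t) := by
      have h6 : (0 : ℝ) < (t - 1 : ℕ) := by exact_mod_cast ht2.1
      have h7 : (t : ℝ) ≤ 2 * (t - 1 : ℕ) := by
        have : t ≤ 2 * (t - 1) := by have := ht.1; omega
        exact_mod_cast this
      rw [div_le_iff₀ h6]
      calc y = y / t * t := by field_simp
        _ ≤ y / t * (2 * (t - 1 : ℕ)) := by gcongr
        _ = _ := by ring
    have h8 : F (t - 1) ≤ 2 * (B + D) * √(y / t) ^ 2 := by
      rw [← hs2] at h3 h5
      rw [← hs2 t] at h5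
      have h9 : √(y / (t - 1 : ℕ)) ≤ √(y / (t - 1 : ℕ)) ^ 2 := by nlinarith
      nlinarith
    have hst : 0 < √(y / t) := by have := hsL t ht1; linarith
    calc F (t - 1) / (F t + L)
        ≤ (2 * (B + D) * √(y / t) ^ 2) / (C₁ * √(y / t) ^ 2 / (2 * l)) := by
          gcongr
          linarith
      _ = 4 * (B + D) / C₁ * l := by field_simp; ring
      _ < H * a * l := by gcongr
      _ = a * (H * L) / l := by rw [← hlL]; field_simp
      _ ≤ a * s / l := by gcongr
  · have ht2 : t - 1 ∈ Set.Icc 1 Kmax := ⟨by omega, by have := ht.2; omega⟩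
    have h2 := hFG (t - 1) ht2
    rw [hG0 (t - 1) ⟨by omega, by have := ht.2; omega⟩, zero_add] at h2
    have h3 : √(y / (t - 1 : ℕ)) ≤ s := hsanti (by omega) (by omega)
    calc F (t - 1) / (F t + L) ≤ (D * s) / L := by
          have := hF t
          gcongr
          · exact h2.trans (by gcongr)
          · linarith
      _ = D * (s / L) := by ring
      _ < (a * l) * (s / L) := by
          have : 0 < L := by linarith
          gcongr
      _ = a * s / l := by rw [← hlL]; field_simp

theorem ratioArgmax_eq_singleton {n K Kmax : ℕ} {c : ℕ → Fin n → ℕ}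
    {M : Matrix (Fin n) (Fin n) ℝ} (hK : K ∈ Set.Icc 2 Kmax)
    (h : ∀ t ∈ Set.Icc 2 Kmax, t ≠ K → criterionRatio c M t < criterionRatio c M K) :
    ratioArgmax Kmax c M = {K} := by
  ext t
  simp only [ratioArgmax, Set.mem_ofPred_eq, Set.mem_singleton_iff]
  constructor
  · rintro ⟨ht, hmax⟩
    by_contra htK
    exact absurd (hmax K hK) (not_le.2 (h t ht htK))
  · rintro rfl
    refine ⟨hK, fun s hs => ?_⟩
    rcases eq_or_ne s t with rfl | hst
    · exact le_rfl
    · exact (h s hs hst).le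

end Ratio

/-! ### Consistency of the estimator -/

section Consistency

open scoped Matrix.Norms.L2Operator

/-- Consistency for a fixed number of vertices, with the asymptotic assumptions replaced by explicit
inequalities between the constants. The parameter `H` bounds the signal-to-noise ratio
`√(n ρ² / K) / log n` from below. -/
theorem IsBernoulliGraph.one_sub_inv_le_measureReal_ratioArgmax {n : ℕ} {Ω : Type*}
    [MeasurableSpace Ω] {P : Measure Ω} [IsProbabilityMeasure P] {Θ : Matrix (Fin n) (Fin n) ℝ}
    {A : Ω → Matrix (Fin n) (Fin n) ℝ} (hA : IsBernoulliGraph P Θ A) {C₀ B C₁ D H ρ : ℝ}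
    {K Kmax : ℕ} {Λ₀ : Fin n → ℕ → ℝ} {cstar : Fin n → ℕ} {c : ℕ → Fin n → ℕ}
    (hΘ : Θ = pabmTheta (fun i k => ρ * Λ₀ i k) cstar) (hC₀ : 1 ≤ C₀) (hB : 2 * C₀ < B)
    (hC₁ : 0 < C₁) (hD : D = noiseConst B + 1) (hK2 : 2 ≤ K) (hKK : K ≤ Kmax)
    (hρ0 : 0 < ρ) (hρ1 : ρ ≤ 1) (hΛ : ∀ i, ∀ k ∈ Set.Icc 1 K, 0 < Λ₀ i k ∧ Λ₀ i k < 1)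
    (hlab : IsLabeling K cstar) (hbal : IsBalanced C₀ K cstar)
    (hc : ∀ t ∈ Set.Icc 1 Kmax, c t ∈ balancedArgmin B t Θ)
    (hid : ∀ t : ℕ, 1 ≤ t → t < K →
      C₁ * (n * ρ ^ 2 / (t * √(Real.log n))) ≤ blockCriterion t (c t) Θ)
    (hgrow : (H * Real.log n) ^ 2 ≤ n * ρ ^ 2 / Kmax) (hH1 : 1 ≤ H) (hH2 : 2 * D / C₁ ≤ H)
    (hH3 : 4 * (B + D) / C₁ < H * (C₁ / (2 * (D + 1)))) (hL : 1 ≤ Real.log n)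
    (hL1 : (1 / (2 * C₀) - 1 / B)⁻¹ ≤ Real.log n) (hL2 : (B - 2 * C₀)⁻¹ ≤ Real.log n)
    (hLD : (D / (C₁ / (2 * (D + 1)))) ^ 2 + 1 ≤ Real.log n) :
    1 - (n : ℝ)⁻¹ ≤ P.real {ω | ratioArgmax Kmax c (A ω) = {K}} := by
  have hB0 : 0 < B := by linarith
  have hD0 : 0 < D := by linarith [noiseConst_nonneg B]
  set a : ℝ := C₁ / (2 * (D + 1)) with ha
  have ha0 : 0 < a := by positivity
  set δ₁ : ℝ := 1 / (2 * C₀) - 1 / B with hδ₁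
  have hδ₁0 : 0 < δ₁ := by
    have : 1 / B < 1 / (2 * C₀) := one_div_lt_one_div_of_lt (by linarith) hB
    linarith
  have hδ₂0 : 0 < B - 2 * C₀ := by linarith
  set L := Real.log n with hLdef
  have hKmax0 : (0 : ℝ) < Kmax := by
    have : 0 < Kmax := by omega
    exact_mod_cast this
  set y : ℝ := n * ρ ^ 2 with hy
  have hy0 : 0 ≤ y := by positivity
  have hρ2 : ρ ^ 2 ≤ 1 := pow_le_one₀ hρ0.le hρ1
  have hyn : y ≤ n := by
    calc y ≤ n * 1 := by rw [hy]; gcongr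
      _ = n := mul_one _
  have hLx : L ^ 2 ≤ y / Kmax := by
    refine le_trans ?_ hgrow
    gcongr
    nlinarith
  have hyt : ∀ t ∈ Set.Icc 1 Kmax, y / Kmax ≤ y / t := fun t ht => by
    have : (0 : ℝ) < t := by exact_mod_cast ht.1
    gcongr
    exact ht.2
  have hKn : Kmax ≤ n := by
    have h1 : 1 ≤ y / Kmax := by nlinarith
    rw [le_div_iff₀ hKmax0] at h1
    have : (Kmax : ℝ) ≤ n := by linarith
    exact_mod_cast this
  -- The communities of the minimizers are large, which leaves room for rounding in refinements.
  have hnt : ∀ t ∈ Set.Icc 1 Kmax, L ≤ n / t := fun t ht => by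
    calc L ≤ L ^ 2 := by nlinarith
      _ ≤ y / t := hLx.trans (hyt t ht)
      _ ≤ n / t := by gcongr
  have hlow : ∀ t ∈ Set.Icc 1 Kmax, 1 ≤ (n : ℝ) / t * δ₁ := fun t ht => by
    have := hL1.trans (hnt t ht)
    rwa [inv_le_iff_one_le_mul₀ hδ₁0] at this
  have hup : ∀ t ∈ Set.Icc 1 Kmax, 1 ≤ (n : ℝ) / t * (B - 2 * C₀) := fun t ht => by
    have := hL2.trans (hnt t ht)
    rwa [inv_le_iff_one_le_mul₀ hδ₂0] at this
  have hΘsymm : ∀ i j, Θ i j = Θ j i := fun i j => by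
    simp only [hΘ, pabmTheta, Matrix.of_apply]; ring
  have hΘ0 : ∀ i j, 0 ≤ Θ i j := fun i j => by
    have h1 := (hΛ i _ (hlab j)).1
    have h2 := (hΛ j _ (hlab i)).1
    simp only [hΘ, pabmTheta, Matrix.of_apply]
    positivity
  have hΘp : ∀ i j, Θ i j ≤ ρ ^ 2 := fun i j => by
    have h1 := hΛ i _ (hlab j)
    have h2 := hΛ j _ (hlab i)
    simp only [hΘ, pabmTheta, Matrix.of_apply]
    calc _ ≤ ρ * 1 * (ρ * 1) := by
          have := h1.1
          have := h2.1
          gcongr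
          · exact h1.2.le
          · exact h2.2.le
      _ = ρ ^ 2 := by ring
  have hsize : ∀ t ∈ Set.Icc 1 Kmax, ∀ k ∈ Set.Icc 1 t,
      (communitySize (c t) k : ℝ) ≤ B * n / t := fun t ht k hk => ((hc t ht).2.1 k hk).2
  have hprob := hA.measureReal_exists_block_noise_le hΘsymm hΘ0 hΘp (sq_nonneg _) hρ2 hsize
    hL hKn (fun t ht => hLx.trans (hyt t ht))
  set bad : Set Ω := {ω | ∃ t ∈ Set.Icc 1 Kmax, ∃ k ∈ Set.Icc 1 t,
      noiseConst B * √(n * ρ ^ 2 / t) < ‖diagBlock (c t) (noiseMatrix Θ (A ω)) k‖}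
    with hbad
  have hgood : {ω | ratioArgmax Kmax c (A ω) = {K}}ᶜ ⊆ bad := by
    intro ω hω
    by_contra hωbad
    refine hω (ratioArgmax_eq_singleton ⟨hK2, hKK⟩ fun t ht htK => ?_)
    have hnoise : ∀ t ∈ Set.Icc 1 Kmax, ∀ k ∈ Set.Icc 1 t,
        ‖diagBlock (c t) (A ω) k - diagBlock (c t) Θ k‖ ≤ D * √(y / t) :=
      fun t ht k hk => by
        have h1 := l2_opNorm_diagBlock_sub_le (Θ := Θ) (M := A ω)
          (fun i => by rw [abs_of_nonneg (hΘ0 i i)]; exact (hΘp i i).trans hρ2)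
          (hA.no_loops ω) (c t) k
        have h2 : ‖diagBlock (c t) (noiseMatrix Θ (A ω)) k‖ ≤ noiseConst B * √(y / t) := by
          by_contra h
          exact hωbad ⟨t, ht, k, hk, not_le.1 h⟩
        have h3 : 1 ≤ √(y / t) := by
          rw [Real.one_le_sqrt]
          have := hLx.trans (hyt t ht)
          nlinarith
        rw [hD]
        linarith
    refine ratio_lt_ratio (F := fun t => blockCriterion t (c t) (A ω))
      (G := fun t => blockCriterion t (c t) Θ) (B := B) (D := D) (y := y) (H := H) hK2
      (fun t => blockCriterion_nonneg _ _ _) hB0.le hC₁ hD0.le hL hy0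
      (fun t ht => blockCriterion_le_add (by positivity) (hnoise t ht))
      (fun t ht => blockCriterion_le_add (by positivity) fun k hk => ?_)
      (fun t ht => ?_) (fun t h1 h2 => hid t h1 h2)
      (fun t ht => ?_) (Real.le_sqrt_of_sq_le hgrow) hH1 hH2 hH3 ?_ hKK ht htK
    · rw [norm_sub_rev]; exact hnoise t ht k hk
    · have ht1 : t ∈ Set.Icc 1 Kmax := ⟨by have := ht.1; omega, ht.2⟩
      have hct := hc t ht1
      rw [hΘ] at hct ⊢
      exact blockCriterion_eq_zero_of_mem_balancedArgmin hC₀ hlab hbal (by omega) ht.1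
        (hlow t ht1) (hup t ht1) hct
    · have := blockCriterion_le_card_mul (sq_nonneg ρ)
        (fun i j => by rw [abs_of_nonneg (hΘ0 i j)]; exact hΘp i j) (by positivity) (hsize t ht)
      refine this.trans (le_of_eq ?_)
      rw [hy]; ring
    · rw [← ha, mul_comm, ← div_lt_iff₀ ha0]
      refine Real.lt_sqrt_of_sq_lt ?_
      linarith
  have hcompl : 1 ≤ P.real {ω | ratioArgmax Kmax c (A ω) = {K}} +
      P.real bad := by
    set E := {ω | ratioArgmax Kmax c (A ω) = {K}}
    calc (1 : ℝ) = P.real (E ∪ Eᶜ) := by rw [Set.union_compl_self]; simp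
      _ ≤ P.real E + P.real Eᶜ := measureReal_union_le _ _
      _ ≤ P.real E + P.real bad :=
          add_le_add_right (measureReal_mono hgood (measure_ne_top P bad)) _
  linarith

end Consistency

theorem mainTheorem6 (C₀ B C₁ ε : ℝ) (hC₀ : 1 ≤ C₀) (hB : 2 * C₀ < B) (hC₁ : 0 < C₁)
    (hε : 0 < ε) :
    ∃ C : ℝ, 0 < C ∧
      ∀ (K Kmax : ℕ → ℕ) (ρ : ℕ → ℝ)
        (Λ₀ : (n : ℕ) → Fin n → ℕ → ℝ) (cstar : (n : ℕ) → Fin n → ℕ)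
        (Θ : (n : ℕ) → Matrix (Fin n) (Fin n) ℝ) (c : (n : ℕ) → ℕ → Fin n → ℕ)
        (Ω : ℕ → Type*) [∀ n, MeasurableSpace (Ω n)]
        (P : (n : ℕ) → Measure (Ω n)) [∀ n, IsProbabilityMeasure (P n)]
        (A : (n : ℕ) → Ω n → Matrix (Fin n) (Fin n) ℝ),
        -- the model
        (∀ n, 2 ≤ K n ∧ K n ≤ Kmax n) →
        (∀ n, 0 < ρ n ∧ ρ n ≤ 1) →
        (∀ n i, ∀ k ∈ Set.Icc 1 (K n), 0 < Λ₀ n i k ∧ Λ₀ n i k < 1) →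
        (∀ n, IsLabeling (K n) (cstar n)) →
        (∀ n, Θ n = pabmTheta (fun i k => ρ n * Λ₀ n i k) (cstar n)) →
        (∀ n, IsBernoulliGraph (P n) (Θ n) (A n)) →
        -- the true communities are balanced
        (∀ᶠ n in atTop, IsBalanced C₀ (K n) (cstar n)) →
        -- `c n t` is any choice of the population minimizer with `t` communities
        (∀ᶠ n in atTop, ∀ t ∈ Set.Icc 1 (Kmax n), c n t ∈ balancedArgmin B t (Θ n)) →
        -- identifiability of the number of communities
        (∀ᶠ n in atTop, ∀ t : ℕ, 1 ≤ t → t < K n →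
          C₁ * (n * ρ n ^ 2 / (t * √(Real.log n))) ≤ blockCriterion t (c n t) (Θ n)) →
        -- growth conditions
        (∀ᶠ n : ℕ in atTop, (Kmax n : ℝ) ≤ (n : ℝ) ^ (1 - ε)) →
        ((fun n : ℕ => Real.log n ^ 2) =o[atTop] fun n : ℕ => ρ n ^ 2 * (n / Kmax n)) →
        ∀ᶠ n : ℕ in atTop,
          1 - (n : ℝ) ^ (-C) ≤ (P n).real {ω | ratioArgmax (Kmax n) (c n) (A n ω) = {K n}} := by
  have hB0 : 0 < B := by linarith
  set D : ℝ := noiseConst B + 1 with hD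
  have hD0 : 0 < D := by linarith [noiseConst_nonneg B]
  set a : ℝ := C₁ / (2 * (D + 1)) with ha
  have ha0 : 0 < a := by positivity
  -- The signal-to-noise ratio `√(n ρ² / K) / log n` has to exceed this constant.
  set H : ℝ := 1 + 2 * D / C₁ + 4 * (B + D) / C₁ / a with hH
  have hH1 : 1 ≤ H := by
    have : 0 ≤ 2 * D / C₁ + 4 * (B + D) / C₁ / a := by positivity
    linarith
  have hH2 : 2 * D / C₁ ≤ H := by
    have : 0 ≤ 4 * (B + D) / C₁ / a := by positivity
    linarith
  have hH3 : 4 * (B + D) / C₁ < H * a := by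
    rw [← div_lt_iff₀ ha0]
    have : 0 ≤ 2 * D / C₁ := by positivity
    linarith
  refine ⟨1, one_pos, ?_⟩
  intro K Kmax ρ Λ₀ cstar Θ c Ω _ P _ A hK hρ hΛ hlab hΘ hA hbal hc hid _ hgrowth
  have hlog : Tendsto (fun n : ℕ => Real.log n) atTop atTop :=
    Real.tendsto_log_atTop.comp tendsto_natCast_atTop_atTop
  have hlog_ge : ∀ b : ℝ, ∀ᶠ n : ℕ in atTop, b ≤ Real.log n := fun b =>
    hlog.eventually_ge_atTop b
  filter_upwards [hbal, hc, hid, hgrowth.bound (show 0 < (H ^ 2)⁻¹ by positivity), hlog_ge 1,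
    hlog_ge (1 / (2 * C₀) - 1 / B)⁻¹, hlog_ge (B - 2 * C₀)⁻¹, hlog_ge ((D / a) ^ 2 + 1)]
    with n hbal hc hid hgrowth hL hL1 hL2 hLD
  obtain ⟨hK2, hKK⟩ := hK n
  obtain ⟨hρ0, hρ1⟩ := hρ n
  have hgrow : (H * Real.log n) ^ 2 ≤ n * ρ n ^ 2 / Kmax n := by
    have e : ρ n ^ 2 * (n / Kmax n) = n * ρ n ^ 2 / Kmax n := by ring
    rw [e, Real.norm_of_nonneg (by positivity), Real.norm_of_nonneg (by positivity),
      inv_mul_eq_div, le_div_iff₀ (by positivity)] at hgrowth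
    rw [mul_pow]
    linarith
  rw [Real.rpow_neg_one]
  exact (hA n).one_sub_inv_le_measureReal_ratioArgmax (hΘ n) hC₀ hB hC₁ hD hK2 hKK hρ0 hρ1 (hΛ n)
    (hlab n) hbal hc hid hgrow hH1 hH2 hH3 hL hL1 hL2 hLD
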